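/- Let $T$ be a finite set of events. A slice over $T$ is a finite directed acyclic multigraph whose vertex set is partitioned into a non-empty center, with vertices labelled by elements of $T$, an in-frontier and an out-frontier, whose vertices are numbered $1,2,\dots$ each; every in-frontier vertex is touched by exactly one edge, which leaves it, and every out-frontier vertex is touched by exactly one edge, which enters it. Isomorphic slices (isomorphisms respecting labels and numberings) are identified. If the out-frontier of $S$ and the in-frontier of $S'$ have the same size, $S\circ S'$ is obtained by gluing, for each $j$, the edge at the $j$-th out-frontier vertex of $S$ with the edge at the $j$-th in-frontier vertex of $S'$. A unit slice has exactly one center vertex; it is non-degenerate if its center is connected to the in-frontier (out-frontier) whenever the latter is non-empty; a slice is initial (final) if its in-frontier (out-frontier) is empty. A DAG is a slice with both frontiers empty. A unit decomposition of a DAG $H$ is a word $S_1S_2\cdots S_n$ of unit slices with $H=S_1\circ S_2\circ\cdots\circ S_n$. A DAG has global slice width at most $c$ if in each of its unit decompositions every frontier of every slice has size at most $c$. A slice graph over $T$ is a finite directed graph without multiple edges (loops allowed) whose vertices are labelled with non-degenerate unit slices over $T$ such that the labels of adjacent vertices can be composed. Its slice language consists of the words of labels along walks from a vertex with an initial label to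 a vertex with a final label; its graph language consists of the DAGs obtained by composing these words; its partial order language consists of the partial orders that are the transitive closures of these DAGs. A slice graph is saturated if every unit decomposition of every DAG in its graph language belongs to its slice language. It is a Hasse diagram generator if every DAG in its graph language is simple (has no multiple edges) and transitively reduced. Then for each $c\ge 1$ there is a saturated Hasse diagram generator on $|T|\cdot 2^{O(c^2)}$ vertices (the constant in the $O$ being independent of $T$; in particular on $2^{O(c^2)}$ vertices for fixed $T$) whose partial order language is exactly the set of finite partial orders labelled by $T$ that have a unique minimal and a unique maximal element and whose Hasse diagrams have global slice width at most $c$. -/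

import Mathlib

/-- A slice over the set of events `T`: a finite labelled directed acyclic multigraph whose vertices
are the `inn` in-frontier vertices, the elements of the non-empty center `V`, and the `out`
out-frontier vertices.  The frontier vertices are identified with their numbers.
Since the unique edge at an in-frontier vertex is outgoing and the unique edge at an out-frontier
vertex is incoming, every edge has its source in the in-frontier or the center and its target in the
center or the out-frontier. -/
structure Slice.{u} (T : Type u) where
  /-- size of the in-frontier -/
  inn : ℕ
  /-- size of the out-frontier -/
  out : ℕ
  /-- center vertices -/
  V : Type
  /-- edges -/
  E : Type
  finV : Finite V
  finE : Finite E
  nonemptyV : Nonempty V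
  /-- labels of the center vertices -/
  label : V → T
  src : E → Fin inn ⊕ V
  tgt : E → V ⊕ Fin out
  /-- the unique edge touching a given in-frontier vertex -/
  inEdge : Fin inn → E
  /-- the unique edge touching a given out-frontier vertex -/
  outEdge : Fin out → E
  src_eq_inl : ∀ e i, src e = Sum.inl i ↔ e = inEdge i
  tgt_eq_inr : ∀ e j, tgt e = Sum.inr j ↔ e = outEdge j
  acyclic : ∀ v : V,
    ¬ Relation.TransGen (fun a b => ∃ e, src e = Sum.inr a ∧ tgt e = Sum.inl b) v v

namespace Slice

universe u
variable {T : Type u}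

/-- There is an edge from the center vertex `a` to the center vertex `b`. -/
def Adj (S : Slice T) (a b : S.V) : Prop :=
  ∃ e, S.src e = Sum.inr a ∧ S.tgt e = Sum.inl b

/-- The transitive closure of the edge relation on center vertices. -/
def Reach (S : Slice T) : S.V → S.V → Prop := Relation.TransGen S.Adj

/-- Isomorphism of slices: it preserves labels, edges, and the numbering of the frontiers. -/
structure Iso (A B : Slice T) where
  hinn : A.inn = B.inn
  hout : A.out = B.out
  onV : A.V ≃ B.V
  onE : A.E ≃ B.E
  label_eq : ∀ v, B.label (onV v) = A.label v
  src_eq : ∀ e, B.src (onE e) = Sum.map (Fin.cast hinn) onV (A.src e)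
  tgt_eq : ∀ e, B.tgt (onE e) = Sum.map onV (Fin.cast hout) (A.tgt e)

/-- Source map of the composition. -/
def compSrc (A B : Slice T) :
    A.E ⊕ {e : B.E // (B.src e).isRight = true} → Fin A.inn ⊕ (A.V ⊕ B.V)
  | Sum.inl e => Sum.map id Sum.inl (A.src e)
  | Sum.inr e => Sum.inr (Sum.inr ((B.src e.1).getRight e.2))

/-- Target map of the composition. -/
def compTgt (A B : Slice T) (h : A.out = B.inn) :
    A.E ⊕ {e : B.E // (B.src e).isRight = true} → (A.V ⊕ B.V) ⊕ Fin B.out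
  | Sum.inl e =>
    match A.tgt e with
    | Sum.inl v => Sum.inl (Sum.inl v)
    | Sum.inr j => Sum.map Sum.inr id (B.tgt (B.inEdge (Fin.cast h j)))
  | Sum.inr e => Sum.map Sum.inr id (B.tgt e.1)

/-- The edge of the composition at the `j`-th out-frontier vertex. -/
def compOutEdge (A B : Slice T) (h : A.out = B.inn) (j : Fin B.out) :
    A.E ⊕ {e : B.E // (B.src e).isRight = true} :=
  match hs : B.src (B.outEdge j) with
  | Sum.inl i => Sum.inl (A.outEdge (Fin.cast h.symm i))
  | Sum.inr _ => Sum.inr ⟨B.outEdge j, by rw [hs]; rfl⟩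

theorem comp_src_eq_inl (A B : Slice T) (e : A.E ⊕ {e : B.E // (B.src e).isRight = true})
    (i : Fin A.inn) : compSrc A B e = Sum.inl i ↔ e = Sum.inl (A.inEdge i) := by
  rcases e with e | e
  · rw [Sum.inl.injEq, ← A.src_eq_inl]
    simp only [compSrc]
    cases A.src e <;> simp
  · simp [compSrc]

theorem comp_tgt_eq_inr (A B : Slice T) (h : A.out = B.inn)
    (e : A.E ⊕ {e : B.E // (B.src e).isRight = true}) (j : Fin B.out) :
    compTgt A B h e = Sum.inr j ↔ e = compOutEdge A B h j := by
  have key : ∀ x : B.E, Sum.map (Sum.inr : B.V → A.V ⊕ B.V) (id : Fin B.out → Fin B.out) (B.tgt x)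
      = Sum.inr j ↔ x = B.outEdge j := by
    intro x
    rw [← B.tgt_eq_inr]
    cases B.tgt x <;> simp
  unfold compOutEdge
  rcases e with e | e
  · rcases ht : A.tgt e with v | k
    · have h1 : compTgt A B h (Sum.inl e) = Sum.inl (Sum.inl v) := by simp [compTgt, ht]
      rw [h1]
      constructor
      · intro hh; cases hh
      · intro hh
        split at hh
        · rw [Sum.inl.injEq, ← A.tgt_eq_inr, ht] at hh
          cases hh
        · cases hh
    · have h1 : compTgt A B h (Sum.inl e)
          = Sum.map Sum.inr id (B.tgt (B.inEdge (Fin.cast h k))) := by simp [compTgt, ht]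
      rw [h1, key]
      constructor
      · intro hh
        have hs0 : B.src (B.outEdge j) = Sum.inl (Fin.cast h k) := by
          rw [B.src_eq_inl]; exact hh.symm
        split
        · rename_i i hs
          rw [hs0] at hs
          obtain rfl := Sum.inl.inj hs
          rw [Sum.inl.injEq, ← A.tgt_eq_inr, ht]
          simp
        · rename_i v hs
          rw [hs0] at hs
          cases hs
      · intro hh
        split at hh
        · rename_i i hs
          rw [Sum.inl.injEq, ← A.tgt_eq_inr, ht] at hh
          obtain rfl := Sum.inr.inj hh
          rw [B.src_eq_inl] at hs
          simpa using hs.symm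
        · cases hh
  · have h1 : compTgt A B h (Sum.inr e) = Sum.map Sum.inr id (B.tgt e.1) := rfl
    rw [h1, key]
    obtain ⟨e, he⟩ := e
    constructor
    · intro hh
      dsimp only at hh
      subst hh
      split
      · rename_i i hs
        rw [hs] at he
        cases he
      · rfl
    · intro hh
      split at hh
      · cases hh
      · exact congrArg Subtype.val (Sum.inr.inj hh)

theorem comp_acyclic (A B : Slice T) (h : A.out = B.inn) (v : A.V ⊕ B.V) :
    ¬ Relation.TransGen
      (fun a b => ∃ e, compSrc A B e = Sum.inr a ∧ compTgt A B h e = Sum.inl b) v v := by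
  have step : ∀ a b : A.V ⊕ B.V,
      (∃ e, compSrc A B e = Sum.inr a ∧ compTgt A B h e = Sum.inl b) →
      (∃ x y, a = Sum.inl x ∧ b = Sum.inl y ∧ A.Adj x y) ∨
      (∃ x y, a = Sum.inl x ∧ b = Sum.inr y) ∨
      (∃ x y, a = Sum.inr x ∧ b = Sum.inr y ∧ B.Adj x y) := by
    rintro a b ⟨e | ⟨e, he⟩, h1, h2⟩
    · rcases hs : A.src e with i | x
      · simp [compSrc, hs] at h1
      · simp only [compSrc, hs, Sum.map_inr, Sum.inr.injEq] at h1
        subst h1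
        rcases ht : A.tgt e with y | j
        · simp only [compTgt, ht, Sum.inl.injEq] at h2
          subst h2
          exact Or.inl ⟨x, y, rfl, rfl, e, hs, ht⟩
        · simp only [compTgt, ht] at h2
          rcases hB : B.tgt (B.inEdge (Fin.cast h j)) with y | k
          · rw [hB] at h2
            simp only [Sum.map_inl, Sum.inl.injEq] at h2
            subst h2
            exact Or.inr (Or.inl ⟨x, y, rfl, rfl⟩)
          · rw [hB] at h2
            simp at h2
    · rcases hs : B.src e with i | x
      · rw [hs] at he; cases he
      · simp only [compSrc, hs, Sum.getRight_inr, Sum.inr.injEq] at h1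
        subst h1
        rcases ht : B.tgt e with y | k
        · simp only [compTgt, ht, Sum.map_inl, Sum.inl.injEq] at h2
          subst h2
          exact Or.inr (Or.inr ⟨x, y, rfl, rfl, e, hs, ht⟩)
        · simp [compTgt, ht] at h2
  have path : ∀ a b : A.V ⊕ B.V, Relation.TransGen
      (fun a b => ∃ e, compSrc A B e = Sum.inr a ∧ compTgt A B h e = Sum.inl b) a b →
      (∃ x y, a = Sum.inl x ∧ b = Sum.inl y ∧ Relation.TransGen A.Adj x y) ∨
      (∃ x y, a = Sum.inl x ∧ b = Sum.inr y) ∨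
      (∃ x y, a = Sum.inr x ∧ b = Sum.inr y ∧ Relation.TransGen B.Adj x y) := by
    intro a b hab
    induction hab with
    | single hb =>
      rcases step _ _ hb with ⟨x, y, rfl, rfl, hxy⟩ | ⟨x, y, rfl, rfl⟩ | ⟨x, y, rfl, rfl, hxy⟩
      · exact Or.inl ⟨x, y, rfl, rfl, .single hxy⟩
      · exact Or.inr (Or.inl ⟨x, y, rfl, rfl⟩)
      · exact Or.inr (Or.inr ⟨x, y, rfl, rfl, .single hxy⟩)
    | tail _ hbc ih =>
      rcases ih with ⟨x, y, rfl, rfl, hxy⟩ | ⟨x, y, rfl, rfl⟩ | ⟨x, y, rfl, rfl, hxy⟩ <;>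
      rcases step _ _ hbc with ⟨p, q, hp, rfl, hpq⟩ | ⟨p, q, hp, rfl⟩ | ⟨p, q, hp, rfl, hpq⟩
      · cases hp; exact Or.inl ⟨x, q, rfl, rfl, hxy.tail hpq⟩
      · exact Or.inr (Or.inl ⟨x, q, rfl, rfl⟩)
      · cases hp
      · cases hp
      · cases hp
      · exact Or.inr (Or.inl ⟨x, q, rfl, rfl⟩)
      · cases hp
      · cases hp
      · cases hp; exact Or.inr (Or.inr ⟨x, q, rfl, rfl, hxy.tail hpq⟩)
  intro hv
  rcases path v v hv with ⟨x, y, rfl, hy, hxy⟩ | ⟨x, y, rfl, hy⟩ | ⟨x, y, rfl, hy, hxy⟩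
  · cases hy; exact A.acyclic x hxy
  · cases hy
  · cases hy; exact B.acyclic x hxy

/-- The composition of two slices: the edge at the `j`-th out-frontier vertex of `A` is glued to the
edge at the `j`-th in-frontier vertex of `B`.  A glued edge is represented by its part in `A`, so the
edges of the composition are the edges of `A` together with the edges of `B` that do not start at the
in-frontier of `B`. -/
def comp (A B : Slice T) (h : A.out = B.inn) : Slice T where
  inn := A.inn
  out := B.out
  V := A.V ⊕ B.V
  E := A.E ⊕ {e : B.E // (B.src e).isRight = true}
  finV := by
    have := A.finV
    have := B.finV
    infer_instance
  finE := by
    have := A.finE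
    have := B.finE
    infer_instance
  nonemptyV := A.nonemptyV.map Sum.inl
  label := Sum.elim A.label B.label
  src := compSrc A B
  tgt := compTgt A B h
  inEdge := fun i => Sum.inl (A.inEdge i)
  outEdge := compOutEdge A B h
  src_eq_inl := comp_src_eq_inl A B
  tgt_eq_inr := comp_tgt_eq_inr A B h
  acyclic := comp_acyclic A B h

/-- `Composes [S₁, …, Sₙ] H`: consecutive slices can be composed and, up to isomorphism,
`H = S₁ ∘ ⋯ ∘ Sₙ`. -/
inductive Composes : List (Slice T) → Slice T → Prop
  | single {S H : Slice T} : Nonempty (Iso S H) → Composes [S] H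
  | cons {S K H : Slice T} {w : List (Slice T)} (h : S.out = K.inn) :
      Composes w K → Nonempty (Iso (S.comp K h) H) → Composes (S :: w) H

/-- A unit slice has exactly one center vertex. -/
def IsUnitSlice (S : Slice T) : Prop := ∃! _v : S.V, True

/-- The slice-width: the size of the greatest frontier. -/
def width (S : Slice T) : ℕ := max S.inn S.out

def IsInitial (S : Slice T) : Prop := S.inn = 0

def IsFinal (S : Slice T) : Prop := S.out = 0

/-- The center is connected to the in-frontier (out-frontier) whenever the latter is non-empty. -/
def IsNondegenerate (S : Slice T) : Prop :=
  (S.inn ≠ 0 → ∃ i v, S.tgt (S.inEdge i) = Sum.inl v) ∧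
  (S.out ≠ 0 → ∃ j v, S.src (S.outEdge j) = Sum.inr v)

/-- The set of unit decompositions of a slice, in particular of a DAG, which is a slice with empty
frontiers. -/
def unitDecompositions (H : Slice T) : Set (List (Slice T)) :=
  {w | (∀ S ∈ w, S.IsUnitSlice) ∧ Composes w H}

/-- Every unit decomposition of `H` has slice width at most `c`. -/
def GlobalSliceWidthLE (H : Slice T) (c : ℕ) : Prop :=
  ∀ w ∈ H.unitDecompositions, ∀ S ∈ w, S.width ≤ c

/-- There are no multiple edges. -/
def IsSimple (H : Slice T) : Prop :=
  ∀ e e' : H.E, H.src e = H.src e' → H.tgt e = H.tgt e' → e = e'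

/-- The edge `e` is superfluous: deleting it does not change the transitive closure. -/
def IsSuperfluous (H : Slice T) (e : H.E) : Prop :=
  ∀ a b : H.V, H.Reach a b ↔ Relation.TransGen
    (fun x y => ∃ e', e' ≠ e ∧ H.src e' = Sum.inr x ∧ H.tgt e' = Sum.inl y) a b

/-- Simple and transitive reduced. -/
def IsTransitiveReduced (H : Slice T) : Prop :=
  H.IsSimple ∧ ∀ e : H.E, ¬ H.IsSuperfluous e

end Slice

/-- A non-empty finite partial order labelled with events from `T`. -/
structure LabelledPoset.{u} (T : Type u) where
  carrier : Type
  order : PartialOrder carrier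
  fin : Finite carrier
  nonempty : Nonempty carrier
  label : carrier → T

namespace LabelledPoset

universe u
variable {T : Type u}

instance (P : LabelledPoset T) : PartialOrder P.carrier := P.order

theorem hasse_acyclic (P : LabelledPoset T) (v : P.carrier) :
    ¬ Relation.TransGen (fun a b => ∃ e : {p : P.carrier × P.carrier // p.1 ⋖ p.2},
      (Sum.inr e.1.1 : Fin 0 ⊕ P.carrier) = Sum.inr a ∧
      (Sum.inl e.1.2 : P.carrier ⊕ Fin 0) = Sum.inl b) v v := by
  have path : ∀ a b : P.carrier, Relation.TransGen
      (fun a b => ∃ e : {p : P.carrier × P.carrier // p.1 ⋖ p.2},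
      (Sum.inr e.1.1 : Fin 0 ⊕ P.carrier) = Sum.inr a ∧
      (Sum.inl e.1.2 : P.carrier ⊕ Fin 0) = Sum.inl b) a b → a < b := by
    have step : ∀ a b : P.carrier, (∃ e : {p : P.carrier × P.carrier // p.1 ⋖ p.2},
        (Sum.inr e.1.1 : Fin 0 ⊕ P.carrier) = Sum.inr a ∧
        (Sum.inl e.1.2 : P.carrier ⊕ Fin 0) = Sum.inl b) → a < b := by
      rintro a b ⟨e, h1, h2⟩
      cases h1
      cases h2
      exact e.2.lt
    intro a b hab
    induction hab with
    | single hb => exact step _ _ hb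
    | tail _ hbc ih => exact ih.trans (step _ _ hbc)
  exact fun hv => lt_irrefl _ (path v v hv)

/-- The Hasse diagram of a finite partial order, as a slice with empty frontiers: its edges are the
covering pairs. -/
def hasse (P : LabelledPoset T) : Slice T where
  inn := 0
  out := 0
  V := P.carrier
  E := {p : P.carrier × P.carrier // p.1 ⋖ p.2}
  finV := P.fin
  finE := by
    have := P.fin
    infer_instance
  nonemptyV := P.nonempty
  label := P.label
  src := fun e => Sum.inr e.1.1
  tgt := fun e => Sum.inl e.1.2
  inEdge := fun i => i.elim0
  outEdge := fun j => j.elim0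
  src_eq_inl := fun _ i => i.elim0
  tgt_eq_inr := fun _ j => j.elim0
  acyclic := P.hasse_acyclic

/-- `P` is, up to isomorphism, the partial order given by the transitive closure of `H`. -/
def IsClosureOf (P : LabelledPoset T) (H : Slice T) : Prop :=
  ∃ f : H.V ≃ P.carrier, (∀ v, P.label (f v) = H.label v) ∧ ∀ a b, H.Reach a b ↔ f a < f b

/-- There is a unique minimal and a unique maximal element. -/
def HasUniqueMinMax (P : LabelledPoset T) : Prop :=
  (∃! x : P.carrier, IsMin x) ∧ ∃! x : P.carrier, IsMax x

end LabelledPoset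

/-- A slice graph: a finite directed graph, possibly with loops but without multiple edges, whose
vertices are labelled with non-degenerate unit slices, and in which adjacent vertices carry
composable slices. -/
structure SliceGraph.{u} (T : Type u) where
  V : Type
  finV : Finite V
  Adj : V → V → Prop
  slice : V → Slice T
  isUnit : ∀ v, (slice v).IsUnitSlice
  isNondegenerate : ∀ v, (slice v).IsNondegenerate
  composable : ∀ v w, Adj v w → (slice v).out = (slice w).inn

namespace SliceGraph

universe u
variable {T : Type u}

/-- The slice language: the words read along the walks from an initial to a final vertex.
Slices that differ by an isomorphism count as the same letter. -/
def sliceLanguage (G : SliceGraph T) : Set (List (Slice T)) :=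
  {w | ∃ p : List G.V, p ≠ [] ∧ p.IsChain G.Adj ∧
    (∀ v ∈ p.head?, (G.slice v).IsInitial) ∧ (∀ v ∈ p.getLast?, (G.slice v).IsFinal) ∧
    List.Forall₂ (fun S S' => Nonempty (Slice.Iso S S')) w (p.map G.slice)}

/-- The DAGs obtained by composing the words of the slice language. -/
def graphLanguage (G : SliceGraph T) : Set (Slice T) :=
  {H | ∃ w ∈ G.sliceLanguage, Slice.Composes w H}

/-- The partial orders obtained as transitive closures of the DAGs in the graph language. -/
def partialOrderLanguage (G : SliceGraph T) : Set (LabelledPoset T) :=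
  {P | ∃ H ∈ G.graphLanguage, P.IsClosureOf H}

/-- Each unit decomposition of each DAG in the graph language is in the slice language. -/
def IsSaturated (G : SliceGraph T) : Prop :=
  ∀ H ∈ G.graphLanguage, H.unitDecompositions ⊆ G.sliceLanguage

/-- All DAGs in the graph language are simple and transitive reduced. -/
def IsHasseDiagramGenerator (G : SliceGraph T) : Prop :=
  ∀ H ∈ G.graphLanguage, H.IsTransitiveReduced

end SliceGraph

-- The bound on the global slice width quantifies over all unit decompositions, but it has a
-- certificate that does not mention them. Every set of vertices closed under predecessors, other
-- than the whole, is the vertex set of a prefix of some unit decomposition, so the width is at most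
-- `c` as soon as every such down-closed cut is crossed by at most `c` edges. For a Hasse diagram
-- with one source and one sink, the dual of max-flow min-cut (flows with lower bound 1 on every
-- edge) turns this into the existence of an integral flow that is at least 1 on every edge and has
-- total value exactly `c`. Conversely, such a flow puts total `c` on every nonempty frontier of
-- every decomposition, with at least 1 on each edge, so no frontier exceeds `c`.
--
-- A DAG is therefore wanted iff it is reduced, has exactly one source and one sink, and carries
-- such a flow (`IsGood`). Each of the three conditions can be tested slice by slice with a bounded
-- memory at the frontier: for reducedness, the relation "the source of the `i`-th frontier edge
-- reaches the source of the `j`-th" (`reduced_comp_iff`); for the flow, its values on the frontier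
-- edges (`hasFlow_comp_iff`); for the terminals, only whether a frontier is empty
-- (`isTwoTerminal_comp_iff`). The generator has as vertices the unit slices annotated with this
-- memory on both sides, and joins two of them when the annotations agree. A relation on `c` edges
-- costs `c ^ 2` bits and a flow `c * log (c + 1)` bits, hence `2 ^ O(c ^ 2)` states per label.
--
-- Saturation comes for free: by `Composes.isGood_iff_run`, a decomposition of `H` is accepted iff
-- `H` is good, whichever decomposition it is. What remains is the flow theorem
-- (`exists_flow_of_cuts_le`), the realization of cuts by decompositions
-- (`exists_mem_unitDecompositions`), and the fact that a reduced DAG is the Hasse diagram of its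
-- closure (`nonempty_iso_hasse`).

universe u
variable {T : Type u}

open Relation

/-! ### Composition of slices: vertices, edges and incidences of the two factors -/

namespace Slice

/-- A center vertex of the first factor, seen in the composition. -/
def leftVertex (A B : Slice T) (h : A.out = B.inn) (v : A.V) : (A.comp B h).V := Sum.inl v

/-- A center vertex of the second factor, seen in the composition. -/
def rightVertex (A B : Slice T) (h : A.out = B.inn) (v : B.V) : (A.comp B h).V := Sum.inr v

/-- The edge of the composition which extends an edge of the first factor. -/
def leftEdge (A B : Slice T) (h : A.out = B.inn) (e : A.E) : (A.comp B h).E := Sum.inl e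

/-- The edge of the composition which extends an edge of the second factor. -/
def rightEdge (A B : Slice T) (h : A.out = B.inn) (f : B.E) : (A.comp B h).E :=
  match hs : B.src f with
  | Sum.inl i => leftEdge A B h (A.outEdge (Fin.cast h.symm i))
  | Sum.inr _ => Sum.inr ⟨f, by rw [hs]; rfl⟩

theorem comp_inn (A B : Slice T) (h : A.out = B.inn) : (A.comp B h).inn = A.inn := rfl

theorem comp_out (A B : Slice T) (h : A.out = B.inn) : (A.comp B h).out = B.out := rfl

/-- The starting point in the composition of an edge of the first factor with the given source. -/
def liftLeft (A B : Slice T) (h : A.out = B.inn) :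
    Fin A.inn ⊕ A.V → Fin (A.comp B h).inn ⊕ (A.comp B h).V :=
  Sum.map (Fin.cast (comp_inn A B h).symm) (leftVertex A B h)

/-- The starting point in the composition of an edge of the second factor with the given source. -/
def liftRight (A B : Slice T) (h : A.out = B.inn) :
    Fin B.inn ⊕ B.V → Fin (A.comp B h).inn ⊕ (A.comp B h).V :=
  Sum.elim (fun i => liftLeft A B h (A.src (A.outEdge (Fin.cast h.symm i))))
    (fun v => Sum.inr (rightVertex A B h v))

@[simp] theorem src_inEdge (S : Slice T) (i : Fin S.inn) : S.src (S.inEdge i) = Sum.inl i :=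
  (S.src_eq_inl _ _).2 rfl

@[simp] theorem tgt_outEdge (S : Slice T) (i : Fin S.out) : S.tgt (S.outEdge i) = Sum.inr i :=
  (S.tgt_eq_inr _ _).2 rfl

theorem inEdge_injective (S : Slice T) : Function.Injective S.inEdge := fun i j hij => by
  have := congrArg S.src hij
  simpa using this

theorem outEdge_injective (S : Slice T) : Function.Injective S.outEdge := fun i j hij => by
  have := congrArg S.tgt hij
  simpa using this

section Comp

variable (A B : Slice T) (h : A.out = B.inn)

variable {A B h} in
theorem comp_vertex_cases (v : (A.comp B h).V) :
    (∃ a, v = leftVertex A B h a) ∨ ∃ b, v = rightVertex A B h b := by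
  rcases v with a | b
  · exact Or.inl ⟨a, rfl⟩
  · exact Or.inr ⟨b, rfl⟩

theorem leftVertex_injective : Function.Injective (leftVertex A B h) := Sum.inl_injective

theorem rightVertex_injective : Function.Injective (rightVertex A B h) := Sum.inr_injective

theorem leftEdge_injective : Function.Injective (leftEdge A B h) := Sum.inl_injective

theorem leftVertex_ne_rightVertex (a : A.V) (b : B.V) :
    leftVertex A B h a ≠ rightVertex A B h b := Sum.inl_ne_inr

@[simp] theorem leftVertex_inj {a b : A.V} :
    leftVertex A B h a = leftVertex A B h b ↔ a = b := (leftVertex_injective A B h).eq_iff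

@[simp] theorem rightVertex_inj {a b : B.V} :
    rightVertex A B h a = rightVertex A B h b ↔ a = b := (rightVertex_injective A B h).eq_iff

theorem rightEdge_inEdge (i : Fin B.inn) :
    rightEdge A B h (B.inEdge i) = leftEdge A B h (A.outEdge (Fin.cast h.symm i)) := by
  unfold rightEdge
  split
  · rename_i j hs
    rw [src_inEdge] at hs
    rw [Sum.inl.inj hs]
  · rename_i hs
    rw [src_inEdge] at hs
    cases hs

theorem rightEdge_of_isRight (f : B.E) (hf : (B.src f).isRight = true) :
    rightEdge A B h f = (Sum.inr ⟨f, hf⟩ : A.E ⊕ {e : B.E // (B.src e).isRight = true}) := by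
  unfold rightEdge
  split
  · rename_i j hs
    rw [hs] at hf
    cases hf
  · rfl

theorem src_leftEdge (e : A.E) :
    (A.comp B h).src (leftEdge A B h e) = liftLeft A B h (A.src e) := rfl

theorem tgt_leftEdge_of_inl {e : A.E} {v : A.V} (hv : A.tgt e = Sum.inl v) :
    (A.comp B h).tgt (leftEdge A B h e) = Sum.inl (leftVertex A B h v) := by
  have : compTgt A B h (Sum.inl e) = Sum.inl (Sum.inl v) := by simp [compTgt, hv]
  exact this

theorem src_rightEdge (f : B.E) :
    (A.comp B h).src (rightEdge A B h f) = liftRight A B h (B.src f) := by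
  rcases hs : B.src f with i | v
  · obtain rfl := (B.src_eq_inl _ _).1 hs
    rw [rightEdge_inEdge]
    rfl
  · rw [rightEdge_of_isRight A B h f (by rw [hs]; rfl)]
    have : compSrc A B (Sum.inr ⟨f, by rw [hs]; rfl⟩) = Sum.inr (Sum.inr v) := by
      simp [compSrc, hs]
    exact this

theorem tgt_rightEdge (f : B.E) :
    (A.comp B h).tgt (rightEdge A B h f) =
      Sum.map (rightVertex A B h) (Fin.cast (comp_out A B h).symm) (B.tgt f) := by
  have key : compTgt A B h (rightEdge A B h f) = Sum.map Sum.inr id (B.tgt f) := by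
    rcases hs : B.src f with i | v
    · obtain rfl := (B.src_eq_inl _ _).1 hs
      rw [rightEdge_inEdge]
      have : A.tgt (A.outEdge (Fin.cast h.symm i)) = Sum.inr (Fin.cast h.symm i) := by simp
      unfold leftEdge
      simp [compTgt]
    · rw [rightEdge_of_isRight A B h f (by rw [hs]; rfl)]
      rfl
  refine Eq.trans key ?_
  cases B.tgt f <;> rfl

theorem tgt_rightEdge_eq_inl {f : B.E} {v : B.V} :
    (A.comp B h).tgt (rightEdge A B h f) = Sum.inl (rightVertex A B h v) ↔
      B.tgt f = Sum.inl v := by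
  rw [tgt_rightEdge]
  cases B.tgt f <;> simp

theorem tgt_rightEdge_ne_left (f : B.E) (v : A.V) :
    (A.comp B h).tgt (rightEdge A B h f) ≠ Sum.inl (leftVertex A B h v) := by
  rw [tgt_rightEdge]
  cases B.tgt f <;> simp [(leftVertex_ne_rightVertex A B h _ _).symm]

-- A glued edge belongs to both factors. Here it is counted with the second factor, where its target
-- can be read off; `comp_edge_cases'` counts it with the first, where its source can be read off.
variable {A B h} in
theorem comp_edge_cases (e : (A.comp B h).E) :
    (∃ a v, e = leftEdge A B h a ∧ A.tgt a = Sum.inl v) ∨ ∃ f, e = rightEdge A B h f := by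
  rcases e with a | ⟨f, hf⟩
  · rcases ha : A.tgt a with v | j
    · exact Or.inl ⟨a, v, rfl, ha⟩
    · refine Or.inr ⟨B.inEdge (Fin.cast h j), ?_⟩
      rw [rightEdge_inEdge]
      rw [A.tgt_eq_inr] at ha
      subst ha
      rfl
  · exact Or.inr ⟨f, (rightEdge_of_isRight A B h f hf).symm⟩

theorem comp_edge_cases' (e : (A.comp B h).E) :
    (∃ a, e = leftEdge A B h a) ∨
      ∃ f v, e = rightEdge A B h f ∧ B.src f = Sum.inr v := by
  rcases e with a | ⟨f, hf⟩
  · exact Or.inl ⟨a, rfl⟩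
  · obtain ⟨v, hv⟩ := Sum.isRight_iff.1 hf
    exact Or.inr ⟨f, v, (rightEdge_of_isRight A B h f hf).symm, hv⟩

theorem liftLeft_injective : Function.Injective (liftLeft A B h) :=
  Function.Injective.sumMap (Fin.cast_injective rfl) (leftVertex_injective A B h)

theorem liftLeft_ne_right (x : Fin A.inn ⊕ A.V) (v : B.V) :
    liftLeft A B h x ≠ Sum.inr (rightVertex A B h v) := by
  cases x <;> simp [liftLeft, leftVertex_ne_rightVertex]

theorem rightEdge_injective : Function.Injective (rightEdge A B h) := by
  intro f g hfg
  have h1 := congrArg (A.comp B h).src hfg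
  rw [src_rightEdge, src_rightEdge] at h1
  rcases hs : B.src f with i | v <;> rcases ht : B.src g with j | w
  · obtain rfl := (B.src_eq_inl _ _).1 hs
    obtain rfl := (B.src_eq_inl _ _).1 ht
    rw [rightEdge_inEdge, rightEdge_inEdge] at hfg
    have := A.outEdge_injective (leftEdge_injective A B h hfg)
    rw [Fin.cast_inj] at this
    rw [this]
  · rw [hs, ht] at h1
    exact absurd h1 (liftLeft_ne_right A B h _ _)
  · rw [hs, ht] at h1
    exact absurd h1.symm (liftLeft_ne_right A B h _ _)
  · rw [rightEdge_of_isRight A B h f (by rw [hs]; rfl),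
      rightEdge_of_isRight A B h g (by rw [ht]; rfl)] at hfg
    exact congrArg Subtype.val (Sum.inr.inj hfg)

theorem comp_outEdge (j : Fin B.out) :
    (A.comp B h).outEdge (Fin.cast (comp_out A B h).symm j) = rightEdge A B h (B.outEdge j) := by
  symm
  rw [← (A.comp B h).tgt_eq_inr, tgt_rightEdge]
  simp

/-- Gluing does not alter the incidences at a center vertex. This bijection and its three companions
transport both the conservation law of flows and the presence of incoming or outgoing edges. -/
theorem bijOn_in_left (v : A.V) : Set.BijOn (leftEdge A B h)
    {e | A.tgt e = Sum.inl v} {e | (A.comp B h).tgt e = Sum.inl (leftVertex A B h v)} := by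
  refine ⟨fun e he => tgt_leftEdge_of_inl A B h he, (leftEdge_injective A B h).injOn,
    fun e (he : _ = _) => ?_⟩
  rcases comp_edge_cases e with ⟨a, w, rfl, ha⟩ | ⟨f, rfl⟩
  · rw [tgt_leftEdge_of_inl A B h ha, Sum.inl.injEq, leftVertex_inj] at he
    exact ⟨a, he ▸ ha, rfl⟩
  · exact absurd he (tgt_rightEdge_ne_left A B h f v)

theorem bijOn_in_right (v : B.V) : Set.BijOn (rightEdge A B h)
    {e | B.tgt e = Sum.inl v} {e | (A.comp B h).tgt e = Sum.inl (rightVertex A B h v)} := by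
  refine ⟨fun e he => (tgt_rightEdge_eq_inl A B h).2 he, (rightEdge_injective A B h).injOn,
    fun e (he : _ = _) => ?_⟩
  rcases comp_edge_cases e with ⟨a, w, rfl, ha⟩ | ⟨f, rfl⟩
  · rw [tgt_leftEdge_of_inl A B h ha, Sum.inl.injEq] at he
    exact absurd he (leftVertex_ne_rightVertex A B h _ _)
  · exact ⟨f, (tgt_rightEdge_eq_inl A B h).1 he, rfl⟩

theorem src_leftEdge_eq_inr {e : A.E} {v : A.V} :
    (A.comp B h).src (leftEdge A B h e) = Sum.inr (leftVertex A B h v) ↔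
      A.src e = Sum.inr v := by
  rw [src_leftEdge]
  cases A.src e <;> simp [liftLeft]

theorem src_rightEdge_eq_inr {e : B.E} {v : B.V} :
    (A.comp B h).src (rightEdge A B h e) = Sum.inr (rightVertex A B h v) ↔
      B.src e = Sum.inr v := by
  rw [src_rightEdge]
  cases B.src e <;> simp [liftRight, liftLeft_ne_right]

theorem bijOn_out_left (v : A.V) : Set.BijOn (leftEdge A B h)
    {e | A.src e = Sum.inr v} {e | (A.comp B h).src e = Sum.inr (leftVertex A B h v)} := by
  refine ⟨fun e he => (src_leftEdge_eq_inr A B h).2 he, (leftEdge_injective A B h).injOn,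
    fun e (he : _ = _) => ?_⟩
  rcases comp_edge_cases' A B h e with ⟨a, rfl⟩ | ⟨f, w, rfl, hf⟩
  · exact ⟨a, (src_leftEdge_eq_inr A B h).1 he, rfl⟩
  · rw [(src_rightEdge_eq_inr A B h).2 hf, Sum.inr.injEq] at he
    exact absurd he.symm (leftVertex_ne_rightVertex A B h _ _)

theorem bijOn_out_right (v : B.V) : Set.BijOn (rightEdge A B h)
    {e | B.src e = Sum.inr v} {e | (A.comp B h).src e = Sum.inr (rightVertex A B h v)} := by
  refine ⟨fun e he => (src_rightEdge_eq_inr A B h).2 he, (rightEdge_injective A B h).injOn,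
    fun e (he : _ = _) => ?_⟩
  rcases comp_edge_cases' A B h e with ⟨a, rfl⟩ | ⟨f, w, rfl, hf⟩
  · exact absurd he (liftLeft_ne_right A B h _ v)
  · exact ⟨f, (src_rightEdge_eq_inr A B h).1 he, rfl⟩

end Comp

/-! ### Isomorphisms of slices -/

namespace Iso

variable {A B C : Slice T}

/-- The identity. -/
def refl (A : Slice T) : Iso A A where
  hinn := rfl
  hout := rfl
  onV := Equiv.refl _
  onE := Equiv.refl _
  label_eq := fun _ => rfl
  src_eq := fun e => by cases h : A.src e <;> simp [h]
  tgt_eq := fun e => by cases h : A.tgt e <;> simp [h]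

/-- The inverse isomorphism. -/
def symm (f : Iso A B) : Iso B A where
  hinn := f.hinn.symm
  hout := f.hout.symm
  onV := f.onV.symm
  onE := f.onE.symm
  label_eq := fun v => by simpa using (f.label_eq (f.onV.symm v)).symm
  src_eq := fun e => by
    have := f.src_eq (f.onE.symm e)
    rw [Equiv.apply_symm_apply] at this
    rw [this]
    cases h : A.src (f.onE.symm e) <;> simp
  tgt_eq := fun e => by
    have := f.tgt_eq (f.onE.symm e)
    rw [Equiv.apply_symm_apply] at this
    rw [this]
    cases h : A.tgt (f.onE.symm e) <;> simp

/-- The composition of isomorphisms. -/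
def trans (f : Iso A B) (g : Iso B C) : Iso A C where
  hinn := f.hinn.trans g.hinn
  hout := f.hout.trans g.hout
  onV := f.onV.trans g.onV
  onE := f.onE.trans g.onE
  label_eq := fun v => by simp [g.label_eq, f.label_eq]
  src_eq := fun e => by
    simp only [Equiv.trans_apply, g.src_eq, f.src_eq]
    cases h : A.src e <;> simp
  tgt_eq := fun e => by
    simp only [Equiv.trans_apply, g.tgt_eq, f.tgt_eq]
    cases h : A.tgt e <;> simp

theorem onE_inEdge (f : Iso A B) (i : Fin A.inn) :
    f.onE (A.inEdge i) = B.inEdge (Fin.cast f.hinn i) := by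
  rw [← B.src_eq_inl, f.src_eq]; simp

theorem onE_outEdge (f : Iso A B) (i : Fin A.out) :
    f.onE (A.outEdge i) = B.outEdge (Fin.cast f.hout i) := by
  rw [← B.tgt_eq_inr, f.tgt_eq]; simp

theorem src_eq_inr_iff (f : Iso A B) (e : A.E) (v : A.V) :
    B.src (f.onE e) = Sum.inr (f.onV v) ↔ A.src e = Sum.inr v := by
  rw [f.src_eq]
  cases A.src e <;> simp

theorem tgt_eq_inl_iff (f : Iso A B) (e : A.E) (v : A.V) :
    B.tgt (f.onE e) = Sum.inl (f.onV v) ↔ A.tgt e = Sum.inl v := by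
  rw [f.tgt_eq]
  cases A.tgt e <;> simp

theorem bijOn_in (f : Iso A B) (v : A.V) :
    Set.BijOn f.onE {e | A.tgt e = Sum.inl v} {e | B.tgt e = Sum.inl (f.onV v)} := by
  refine ⟨fun e he => (f.tgt_eq_inl_iff e v).2 he, f.onE.injective.injOn, fun e he => ?_⟩
  refine ⟨f.onE.symm e, ?_, by simp⟩
  rw [Set.mem_ofPred_eq, ← f.tgt_eq_inl_iff]
  simpa using he

theorem bijOn_out (f : Iso A B) (v : A.V) :
    Set.BijOn f.onE {e | A.src e = Sum.inr v} {e | B.src e = Sum.inr (f.onV v)} := by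
  refine ⟨fun e he => (f.src_eq_inr_iff e v).2 he, f.onE.injective.injOn, fun e he => ?_⟩
  refine ⟨f.onE.symm e, ?_, by simp⟩
  rw [Set.mem_ofPred_eq, ← f.src_eq_inr_iff]
  simpa using he

theorem isUnitSlice (f : Iso A B) (h : A.IsUnitSlice) : B.IsUnitSlice := by
  obtain ⟨v, -, hv⟩ := h
  refine ⟨f.onV v, trivial, fun w _ => ?_⟩
  rw [← hv (f.onV.symm w) trivial]
  simp

end Iso

theorem Composes.congr {w : List (Slice T)} {H H' : Slice T} (hw : Composes w H)
    (f : Iso H H') : Composes w H' := by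
  cases hw with
  | single hS => exact .single (hS.map fun g => g.trans f)
  | cons h hK hS => exact .cons h hK (hS.map fun g => g.trans f)

end Slice

namespace Slice

/-! ### Reachability of edge sources -/

/-- One step between points where edges start: given knowledge `ρ` about the in-frontier, or an
edge. -/
def BelowStep (S : Slice T) (ρ : ℕ → ℕ → Prop) (x y : Fin S.inn ⊕ S.V) : Prop :=
  (∃ i j : Fin S.inn, x = Sum.inl i ∧ y = Sum.inl j ∧ ρ i j) ∨
    ∃ e v, S.src e = x ∧ S.tgt e = Sum.inl v ∧ y = Sum.inr v

/-- Reachability between points where edges start, given knowledge `ρ` about the sources of the edges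
which enter through the in-frontier. -/
def Below (S : Slice T) (ρ : ℕ → ℕ → Prop) : Fin S.inn ⊕ S.V → Fin S.inn ⊕ S.V → Prop :=
  Relation.ReflTransGen (S.BelowStep ρ)

/-- No edge into a vertex is implied by another edge into the same vertex. -/
def Reduced (S : Slice T) (ρ : ℕ → ℕ → Prop) : Prop :=
  ∀ e e' v, S.tgt e = Sum.inl v → S.tgt e' = Sum.inl v → S.Below ρ (S.src e) (S.src e') → e = e'

/-- The knowledge `ρ'` about the sources of the edges leaving through the out-frontier is the one
derived from the knowledge `ρ` about the in-frontier. -/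
def Transfers (S : Slice T) (ρ ρ' : ℕ → ℕ → Prop) : Prop :=
  ∀ i j : Fin S.out, ρ' i j ↔ S.Below ρ (S.src (S.outEdge i)) (S.src (S.outEdge j))

theorem exists_transfers (S : Slice T) (ρ : ℕ → ℕ → Prop) : ∃ ρ', S.Transfers ρ ρ' :=
  ⟨fun i j => ∃ (hi : i < S.out) (hj : j < S.out),
    S.Below ρ (S.src (S.outEdge ⟨i, hi⟩)) (S.src (S.outEdge ⟨j, hj⟩)),
    fun i j => ⟨fun ⟨_, _, h⟩ => h, fun h => ⟨i.2, j.2, h⟩⟩⟩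

section Comp

variable {A B : Slice T} {h : A.out = B.inn} {ρ ρ' : ℕ → ℕ → Prop}

theorem Below.liftLeft {x y : Fin A.inn ⊕ A.V} (hxy : A.Below ρ x y) :
    (A.comp B h).Below ρ (liftLeft A B h x) (liftLeft A B h y) := by
  refine Relation.ReflTransGen.lift (r := BelowStep A ρ) _ (fun x y hxy => ?_) _ _ hxy
  rcases hxy with ⟨i, j, rfl, rfl, hij⟩ | ⟨e, v, rfl, hv, rfl⟩
  · exact Or.inl ⟨_, _, rfl, rfl, hij⟩
  · exact Or.inr ⟨leftEdge A B h e, _, src_leftEdge A B h e, tgt_leftEdge_of_inl A B h hv, rfl⟩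

/-- No edge leads from the second factor back into the first, so a path that ends in the first
factor never left it. -/
theorem below_liftLeft_iff {x y : Fin A.inn ⊕ A.V} :
    (A.comp B h).Below ρ (liftLeft A B h x) (liftLeft A B h y) ↔ A.Below ρ x y := by
  refine ⟨fun hxy => ?_, Below.liftLeft⟩
  suffices H : ∀ z, (A.comp B h).Below ρ (liftLeft A B h x) z → ∀ y, z = liftLeft A B h y →
      A.Below ρ x y from H _ hxy _ rfl
  intro z hz
  induction hz with
  | refl =>
    intro y hy
    rw [liftLeft_injective A B h hy]
    exact .refl
  | tail _ hstep ih =>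
    intro y hy
    rcases hstep with ⟨i, j, rfl, rfl, hij⟩ | ⟨e, v, rfl, hv, rfl⟩
    · refine (ih (Sum.inl (Fin.cast (comp_inn A B h) i)) rfl).tail
        (Or.inl ⟨_, Fin.cast (comp_inn A B h) j, rfl, ?_, hij⟩)
      exact liftLeft_injective A B h hy.symm
    · rcases comp_edge_cases e with ⟨a, w, rfl, ha⟩ | ⟨f, rfl⟩
      · refine (ih _ (src_leftEdge A B h a)).tail (Or.inr ⟨a, w, rfl, ha, ?_⟩)
        apply liftLeft_injective A B h
        rw [tgt_leftEdge_of_inl A B h ha] at hv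
        rw [← hy, ← Sum.inl.inj hv]
        rfl
      · rcases y with i | y
        · cases hy
        · rw [Sum.inr.inj hy] at hv
          exact absurd hv (tgt_rightEdge_ne_left A B h f y)

/-- A path between sources of edges of `B` consists of a stretch inside `A`, possibly empty,
followed by a stretch inside `B`. The stretch in `A` joins the sources of two glued edges, which is
exactly what `ρ'` records. Hence the relation on the frontier is all that has to be remembered about
`A`. -/
theorem below_liftRight_iff (hρ : A.Transfers ρ ρ') {x y : Fin B.inn ⊕ B.V} :
    (A.comp B h).Below ρ (liftRight A B h x) (liftRight A B h y) ↔ B.Below ρ' x y := by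
  constructor
  · intro hxy
    -- Invariant along the path: either it is still in `A`, having started at the source of a glued
    -- edge, or it has reached a vertex of `B` and its history is already expressed by `ρ'`.
    have key : ∀ z, (A.comp B h).Below ρ (liftRight A B h x) z →
        (∃ i z', x = Sum.inl i ∧ z = liftLeft A B h z' ∧
          A.Below ρ (A.src (A.outEdge (Fin.cast h.symm i))) z') ∨
        ∃ v, z = Sum.inr (rightVertex A B h v) ∧ B.Below ρ' x (Sum.inr v) := by
      intro z hz
      induction hz with
      | refl =>
        rcases x with i | v
        · exact Or.inl ⟨i, _, rfl, rfl, .refl⟩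
        · exact Or.inr ⟨v, rfl, .refl⟩
      | @tail z w _ hstep ih =>
        rcases hstep with ⟨i, j, rfl, rfl, hij⟩ | ⟨e, v, rfl, hv, rfl⟩
        · rcases ih with ⟨k, z', rfl, hz', hk⟩ | ⟨v, hv, _⟩
          · refine Or.inl ⟨k, Sum.inl (Fin.cast (comp_inn A B h) j), rfl, rfl, hk.tail ?_⟩
            refine Or.inl ⟨Fin.cast (comp_inn A B h) i, _, ?_, rfl, hij⟩
            exact liftLeft_injective A B h hz'.symm
          · cases hv
        · rcases comp_edge_cases e with ⟨a, w, rfl, ha⟩ | ⟨f, rfl⟩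
          · rw [tgt_leftEdge_of_inl A B h ha, Sum.inl.injEq] at hv
            rw [src_leftEdge] at ih
            rcases ih with ⟨k, z', rfl, hz', hk⟩ | ⟨v, hv, _⟩
            · refine Or.inl ⟨k, Sum.inr w, rfl, by rw [← hv]; rfl, hk.tail ?_⟩
              exact Or.inr ⟨a, w, liftLeft_injective A B h hz', ha, rfl⟩
            · exact absurd hv (liftLeft_ne_right A B h _ _)
          · rw [src_rightEdge] at ih
            rw [tgt_rightEdge] at hv
            rcases ht : B.tgt f with w | j
            · rw [ht, Sum.map_inl, Sum.inl.injEq] at hv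
              refine Or.inr ⟨w, by rw [hv], ?_⟩
              rcases hs : B.src f with j | b
              · rw [hs] at ih
                rcases ih with ⟨k, z', rfl, hz', hk⟩ | ⟨v, hv, _⟩
                · refine Relation.ReflTransGen.tail (b := Sum.inl j) (.single ?_)
                    (Or.inr ⟨f, w, hs, ht, rfl⟩)
                  refine Or.inl ⟨k, j, rfl, rfl, ?_⟩
                  rw [← liftLeft_injective A B h hz'] at hk
                  exact (hρ (Fin.cast h.symm k) (Fin.cast h.symm j)).2 hk
                · exact absurd hv (liftLeft_ne_right A B h _ _)
              · rw [hs] at ih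
                rcases ih with ⟨k, z', rfl, hz', hk⟩ | ⟨v, hv, hxv⟩
                · exact absurd hz'.symm (liftLeft_ne_right A B h _ _)
                · rw [← (rightVertex_injective A B h (Sum.inr.inj hv))] at hxv
                  exact hxv.tail (Or.inr ⟨f, w, hs, ht, rfl⟩)
            · rw [ht] at hv; cases hv
    rcases key _ hxy with ⟨i, z', rfl, hz', hi⟩ | ⟨v, hv, hxv⟩
    · rcases y with j | v
      · refine .single (Or.inl ⟨i, j, rfl, rfl, ?_⟩)
        rw [← liftLeft_injective A B h hz'] at hi
        exact (hρ (Fin.cast h.symm i) (Fin.cast h.symm j)).2 hi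
      · exact absurd hz'.symm (liftLeft_ne_right A B h _ _)
    · rcases y with j | w
      · exact absurd hv (liftLeft_ne_right A B h _ _)
      · rwa [rightVertex_injective A B h (Sum.inr.inj hv)]
  · intro hxy
    induction hxy with
    | refl => exact .refl
    | tail _ hstep ih =>
      refine ih.trans ?_
      rcases hstep with ⟨i, j, rfl, rfl, hij⟩ | ⟨e, v, rfl, hv, rfl⟩
      · exact Below.liftLeft ((hρ (Fin.cast h.symm i) (Fin.cast h.symm j)).1 hij)
      · exact .single (Or.inr ⟨rightEdge A B h e, _, src_rightEdge A B h e,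
          (tgt_rightEdge_eq_inl A B h).2 hv, rfl⟩)

/-- All edges into a given vertex come from the factor containing that vertex, so the condition
splits vertex by vertex; the reachability it refers to is compared by the two preceding lemmas. -/
theorem reduced_comp_iff (hρ : A.Transfers ρ ρ') :
    (A.comp B h).Reduced ρ ↔ A.Reduced ρ ∧ B.Reduced ρ' := by
  constructor
  · refine fun H => ⟨fun e e' v hv hv' he => ?_, fun e e' v hv hv' he => ?_⟩
    · exact leftEdge_injective A B h (H _ _ _ (tgt_leftEdge_of_inl A B h hv)
        (tgt_leftEdge_of_inl A B h hv') (below_liftLeft_iff.2 he))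
    · refine rightEdge_injective A B h (H _ _ _ ((tgt_rightEdge_eq_inl A B h).2 hv)
        ((tgt_rightEdge_eq_inl A B h).2 hv') ?_)
      rw [src_rightEdge, src_rightEdge]
      exact (below_liftRight_iff hρ).2 he
  · rintro ⟨HA, HB⟩ e e' v hv hv' he
    rcases comp_vertex_cases v with ⟨v, rfl⟩ | ⟨v, rfl⟩
    · obtain ⟨a, ha, rfl⟩ := (bijOn_in_left A B h v).surjOn hv
      obtain ⟨b, hb, rfl⟩ := (bijOn_in_left A B h v).surjOn hv'
      rw [HA a b v ha hb (below_liftLeft_iff.1 he)]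
    · obtain ⟨a, ha, rfl⟩ := (bijOn_in_right A B h v).surjOn hv
      obtain ⟨b, hb, rfl⟩ := (bijOn_in_right A B h v).surjOn hv'
      rw [src_rightEdge, src_rightEdge] at he
      rw [HB a b v ha hb ((below_liftRight_iff hρ).1 he)]

end Comp

section Iso

variable {A B : Slice T} {ρ ρ' : ℕ → ℕ → Prop}

theorem Below.map (f : Iso A B) {x y : Fin A.inn ⊕ A.V} (hxy : A.Below ρ x y) :
    B.Below ρ (Sum.map (Fin.cast f.hinn) f.onV x) (Sum.map (Fin.cast f.hinn) f.onV y) := by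
  refine Relation.ReflTransGen.lift (r := BelowStep A ρ) _ (fun x y hxy => ?_) _ _ hxy
  rcases hxy with ⟨i, j, rfl, rfl, hij⟩ | ⟨e, v, rfl, hv, rfl⟩
  · exact Or.inl ⟨_, _, rfl, rfl, hij⟩
  · exact Or.inr ⟨f.onE e, _, f.src_eq e, (f.tgt_eq_inl_iff e v).2 hv, rfl⟩

theorem Reduced.congr (f : Iso A B) (H : A.Reduced ρ) : B.Reduced ρ := by
  intro e e' v hv hv' he
  have hm := he.map f.symm
  rw [← f.symm.src_eq, ← f.symm.src_eq] at hm
  exact f.symm.onE.injective (H _ _ _ ((f.symm.tgt_eq_inl_iff e v).2 hv)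
    ((f.symm.tgt_eq_inl_iff e' v).2 hv') hm)

theorem below_src_iff (f : Iso A B) (e e' : A.E) :
    B.Below ρ (B.src (f.onE e)) (B.src (f.onE e')) ↔ A.Below ρ (A.src e) (A.src e') := by
  constructor
  · intro H
    have := H.map f.symm
    rw [← f.symm.src_eq, ← f.symm.src_eq] at this
    simpa [Iso.symm] using this
  · intro H
    rw [f.src_eq, f.src_eq]
    exact H.map f

theorem Transfers.congr (f : Iso A B) (H : A.Transfers ρ ρ') : B.Transfers ρ ρ' := by
  intro i j
  have := H (Fin.cast f.hout.symm i) (Fin.cast f.hout.symm j)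
  rw [← below_src_iff f, f.onE_outEdge, f.onE_outEdge] at this
  exact this

end Iso

/-! ### Flows -/

open Classical in
/-- The sum of `M` over `s`, with the value `c` if `s` is empty. -/
noncomputable def sumOr {E : Type} (c : ℕ) (s : Set E) (M : E → ℕ) : ℕ :=
  if s.Nonempty then ∑ᶠ e ∈ s, M e else c

theorem sumOr_of_nonempty {E : Type} {c : ℕ} {s : Set E} {M : E → ℕ} (hs : s.Nonempty) :
    sumOr c s M = ∑ᶠ e ∈ s, M e := if_pos hs

theorem sumOr_empty {E : Type} {c : ℕ} {M : E → ℕ} : sumOr c ∅ M = c :=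
  if_neg Set.not_nonempty_empty

theorem sumOr_of_bijOn {E F : Type} {c : ℕ} {s : Set E} {t : Set F} {f : E → F}
    (hf : Set.BijOn f s t) (M : F → ℕ) : sumOr c t M = sumOr c s (M ∘ f) := by
  have hne : t.Nonempty ↔ s.Nonempty := by
    rw [← hf.image_eq, Set.image_nonempty]
  by_cases hs : s.Nonempty
  · rw [sumOr_of_nonempty hs, sumOr_of_nonempty (hne.2 hs)]
    exact (finsum_mem_eq_of_bijOn f hf fun _ _ => rfl).symm
  · rw [sumOr, sumOr, if_neg hs, if_neg (mt hne.1 hs)]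

/-- A positive flow, conserved at each vertex.  Sources and sinks are treated as if an amount of `c`
entered or left there. -/
def IsFlow (S : Slice T) (c : ℕ) (M : S.E → ℕ) : Prop :=
  (∀ e, 1 ≤ M e) ∧
    ∀ v, sumOr c {e | S.tgt e = Sum.inl v} M = sumOr c {e | S.src e = Sum.inr v} M

/-- There is a flow which takes the values `m` and `m'` at the frontiers and which has total value
`c`. -/
def HasFlow (S : Slice T) (c : ℕ) (m m' : ℕ → ℕ) : Prop :=
  ∃ M, S.IsFlow c M ∧ (∀ i, M (S.inEdge i) = m i) ∧ (∀ j, M (S.outEdge j) = m' j) ∧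
    (S.inn ≠ 0 → ∑ i : Fin S.inn, m i = c) ∧ (S.out ≠ 0 → ∑ j : Fin S.out, m' j = c)

theorem isFlow_comp_iff {A B : Slice T} {h : A.out = B.inn} {c : ℕ} {M : (A.comp B h).E → ℕ} :
    (A.comp B h).IsFlow c M ↔
      A.IsFlow c (M ∘ leftEdge A B h) ∧ B.IsFlow c (M ∘ rightEdge A B h) := by
  constructor
  · rintro ⟨h1, h2⟩
    refine ⟨⟨fun e => h1 _, fun v => ?_⟩, ⟨fun e => h1 _, fun v => ?_⟩⟩
    · rw [← sumOr_of_bijOn (bijOn_in_left A B h v), ← sumOr_of_bijOn (bijOn_out_left A B h v), h2]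
    · rw [← sumOr_of_bijOn (bijOn_in_right A B h v), ← sumOr_of_bijOn (bijOn_out_right A B h v), h2]
  · rintro ⟨⟨h1, h2⟩, ⟨h3, h4⟩⟩
    refine ⟨fun e => ?_, fun v => ?_⟩
    · rcases comp_edge_cases e with ⟨a, w, rfl, ha⟩ | ⟨f, rfl⟩
      exacts [h1 a, h3 f]
    · rcases comp_vertex_cases v with ⟨v, rfl⟩ | ⟨v, rfl⟩
      · rw [sumOr_of_bijOn (bijOn_in_left A B h v), sumOr_of_bijOn (bijOn_out_left A B h v), h2]
      · rw [sumOr_of_bijOn (bijOn_in_right A B h v), sumOr_of_bijOn (bijOn_out_right A B h v), h4]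

theorem IsFlow.congr {A B : Slice T} (f : Iso A B) {c : ℕ} {M : A.E → ℕ} (hM : A.IsFlow c M) :
    B.IsFlow c (M ∘ f.symm.onE) :=
  ⟨fun _ => hM.1 _, fun v => by
    rw [← sumOr_of_bijOn (f.symm.bijOn_in v), ← sumOr_of_bijOn (f.symm.bijOn_out v), hM.2]⟩

theorem sum_fin_eq {a b : ℕ} (h : a = b) (m : ℕ → ℕ) : ∑ i : Fin a, m i = ∑ i : Fin b, m i := by
  subst h; rfl

theorem HasFlow.congr {A B : Slice T} (f : Iso A B) {c : ℕ} {m m' : ℕ → ℕ}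
    (hM : A.HasFlow c m m') : B.HasFlow c m m' := by
  obtain ⟨M, h1, h2, h3, h4, h5⟩ := hM
  refine ⟨_, h1.congr f, fun i => ?_, fun j => ?_, fun h => ?_, fun h => ?_⟩
  · rw [Function.comp_apply, f.symm.onE_inEdge, h2]; rfl
  · rw [Function.comp_apply, f.symm.onE_outEdge, h3]; rfl
  · rw [sum_fin_eq f.hinn.symm]; exact h4 (f.hinn ▸ h)
  · rw [sum_fin_eq f.hout.symm]; exact h5 (f.hout ▸ h)

/-- Values of at least 1 that sum to `c` leave room for at most `c` edges. Through this bound a flow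
limits the slice width. -/
theorem HasFlow.inn_le {S : Slice T} {c : ℕ} {m m' : ℕ → ℕ} (h : S.HasFlow c m m') :
    S.inn ≤ c := by
  obtain ⟨M, h1, h2, h3, h4, h5⟩ := h
  by_cases h0 : S.inn = 0
  · omega
  · rw [← h4 h0]
    calc S.inn = ∑ i : Fin S.inn, 1 := by simp
      _ ≤ _ := Finset.sum_le_sum fun i _ => by rw [← h2]; exact h1.1 _

theorem HasFlow.out_le {S : Slice T} {c : ℕ} {m m' : ℕ → ℕ} (h : S.HasFlow c m m') :
    S.out ≤ c := by
  obtain ⟨M, h1, h2, h3, h4, h5⟩ := h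
  by_cases h0 : S.out = 0
  · omega
  · rw [← h5 h0]
    calc S.out = ∑ i : Fin S.out, 1 := by simp
      _ ≤ _ := Finset.sum_le_sum fun i _ => by rw [← h3]; exact h1.1 _

theorem HasFlow.le_of_inn {S : Slice T} {c : ℕ} {m m' : ℕ → ℕ} (h : S.HasFlow c m m')
    (i : Fin S.inn) : m i ≤ c := by
  obtain ⟨M, h1, h2, h3, h4, h5⟩ := h
  rw [← h4 (by have := i.2; omega)]
  exact Finset.single_le_sum (f := fun i : Fin S.inn => m i) (fun _ _ => Nat.zero_le _)
    (Finset.mem_univ i)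

theorem HasFlow.le_of_out {S : Slice T} {c : ℕ} {m m' : ℕ → ℕ} (h : S.HasFlow c m m')
    (i : Fin S.out) : m' i ≤ c := by
  obtain ⟨M, h1, h2, h3, h4, h5⟩ := h
  rw [← h5 (by have := i.2; omega)]
  exact Finset.single_le_sum (f := fun i : Fin S.out => m' i) (fun _ _ => Nat.zero_le _)
    (Finset.mem_univ i)

/-! ### Sources and sinks -/

/-- Sources exist only if the in-frontier is empty, and then only one; likewise for sinks. -/
def IsTwoTerminal (S : Slice T) : Prop :=
  (S.inn = 0 → ∃! v, ¬ ∃ e, S.tgt e = Sum.inl v) ∧ (S.inn ≠ 0 → ∀ v, ∃ e, S.tgt e = Sum.inl v) ∧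
  (S.out = 0 → ∃! v, ¬ ∃ e, S.src e = Sum.inr v) ∧ (S.out ≠ 0 → ∀ v, ∃ e, S.src e = Sum.inr v)

theorem exists_source (S : Slice T) (h : S.inn = 0) : ∃ v, ¬ ∃ e, S.tgt e = Sum.inl v := by
  have := S.finV
  have : IsTrans S.V (Relation.TransGen S.Adj) := ⟨fun _ _ _ => Relation.TransGen.trans⟩
  have : Std.Irrefl (Relation.TransGen S.Adj) := ⟨S.acyclic⟩
  obtain ⟨v, -, hv⟩ := (Finite.wellFounded_of_trans_of_irrefl (Relation.TransGen S.Adj)).has_min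
    Set.univ ⟨S.nonemptyV.some, trivial⟩
  refine ⟨v, fun ⟨e, he⟩ => ?_⟩
  rcases hs : S.src e with i | u
  · have := i.2; omega
  · exact hv u trivial (.single ⟨e, hs, he⟩)

theorem exists_sink (S : Slice T) (h : S.out = 0) : ∃ v, ¬ ∃ e, S.src e = Sum.inr v := by
  have := S.finV
  have : IsTrans S.V (Function.swap (Relation.TransGen S.Adj)) :=
    ⟨fun _ _ _ h1 h2 => Relation.TransGen.trans h2 h1⟩
  have : Std.Irrefl (Function.swap (Relation.TransGen S.Adj)) := ⟨S.acyclic⟩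
  obtain ⟨v, -, hv⟩ := (Finite.wellFounded_of_trans_of_irrefl
    (Function.swap (Relation.TransGen S.Adj))).has_min Set.univ ⟨S.nonemptyV.some, trivial⟩
  refine ⟨v, fun ⟨e, he⟩ => ?_⟩
  rcases hs : S.tgt e with u | i
  · exact hv u trivial (.single ⟨e, he, hs⟩)
  · have := i.2; omega

theorem exists_mem_iff_of_bijOn {E F : Type} {s : Set E} {t : Set F} {f : E → F}
    (hf : Set.BijOn f s t) : (∃ e, e ∈ t) ↔ ∃ e, e ∈ s := by
  change t.Nonempty ↔ s.Nonempty
  rw [← hf.image_eq, Set.image_nonempty]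

/-- An empty in-frontier forces a source by acyclicity, and an empty out-frontier a sink. So when
`A.inn = 0` the unique source of the composition lies in `A`, and when `B.out = 0` its unique sink
lies in `B`; nothing is left over for the other factor. -/
theorem isTwoTerminal_comp_iff {A B : Slice T} {h : A.out = B.inn} :
    (A.comp B h).IsTwoTerminal ↔ A.out ≠ 0 ∧ A.IsTwoTerminal ∧ B.IsTwoTerminal := by
  have i1 : ∀ v, _ ↔ _ := fun v => exists_mem_iff_of_bijOn (bijOn_in_left A B h v)
  have i2 : ∀ v, _ ↔ _ := fun v => exists_mem_iff_of_bijOn (bijOn_in_right A B h v)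
  have o1 : ∀ v, _ ↔ _ := fun v => exists_mem_iff_of_bijOn (bijOn_out_left A B h v)
  have o2 : ∀ v, _ ↔ _ := fun v => exists_mem_iff_of_bijOn (bijOn_out_right A B h v)
  simp only [Set.mem_ofPred_eq] at i1 i2 o1 o2
  constructor
  · rintro ⟨h1, h2, h3, h4⟩
    have hin : (A.inn = 0 → ∃! v, ¬ ∃ e, A.tgt e = Sum.inl v) ∧
        (A.inn ≠ 0 → ∀ v, ∃ e, A.tgt e = Sum.inl v) ∧ ∀ v, ∃ e, B.tgt e = Sum.inl v := by
      by_cases hA : A.inn = 0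
      · obtain ⟨s, hs⟩ := A.exists_source hA
        obtain ⟨v, hv, hv'⟩ := h1 hA
        have hsv := hv' _ (mt (i1 s).1 hs)
        subst hsv
        refine ⟨fun _ => ⟨s, hs, fun w hw => ?_⟩, fun h => absurd hA h, fun w => ?_⟩
        · exact leftVertex_injective A B h (hv' _ (mt (i1 w).1 hw))
        · by_contra hw
          exact leftVertex_ne_rightVertex A B h _ _ (hv' _ (mt (i2 w).1 hw)).symm
      · exact ⟨fun h => absurd h hA, fun _ v => (i1 v).1 (h2 hA _), fun v => (i2 v).1 (h2 hA _)⟩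
    have hout : (B.out = 0 → ∃! v, ¬ ∃ e, B.src e = Sum.inr v) ∧
        (B.out ≠ 0 → ∀ v, ∃ e, B.src e = Sum.inr v) ∧ ∀ v, ∃ e, A.src e = Sum.inr v := by
      by_cases hA : B.out = 0
      · obtain ⟨s, hs⟩ := B.exists_sink hA
        obtain ⟨v, hv, hv'⟩ := h3 hA
        have hsv := hv' _ (mt (o2 s).1 hs)
        subst hsv
        refine ⟨fun _ => ⟨s, hs, fun w hw => ?_⟩, fun h => absurd hA h, fun w => ?_⟩
        · exact rightVertex_injective A B h (hv' _ (mt (o2 w).1 hw))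
        · by_contra hw
          exact leftVertex_ne_rightVertex A B h _ _ (hv' _ (mt (o1 w).1 hw))
      · exact ⟨fun h => absurd h hA, fun _ v => (o2 v).1 (h4 hA _), fun v => (o1 v).1 (h4 hA _)⟩
    -- With an empty frontier in between, `A` would contain a sink, but all its vertices have
    -- outgoing edges.
    have hk : A.out ≠ 0 := fun h0 => by
      obtain ⟨v, hv⟩ := A.exists_sink h0
      exact hv (hout.2.2 v)
    exact ⟨hk, ⟨hin.1, hin.2.1, fun h => absurd h hk, fun _ => hout.2.2⟩,
      fun h0 => absurd (h.trans h0) hk, fun _ => hin.2.2, hout.1, hout.2.1⟩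
  · rintro ⟨hk, ⟨h1, h2, h3, h4⟩, h5, h6, h7, h8⟩
    have hB := h6 (h ▸ hk)
    have hA := h4 hk
    refine ⟨fun h0 => ?_, fun h0 v => ?_, fun h0 => ?_, fun h0 v => ?_⟩
    · obtain ⟨s, hs, hs'⟩ := h1 h0
      refine ⟨leftVertex A B h s, mt (i1 s).1 hs, fun w hw => ?_⟩
      rcases comp_vertex_cases w with ⟨v, rfl⟩ | ⟨v, rfl⟩
      · rw [hs' v (mt (i1 v).2 hw)]
      · exact absurd ((i2 v).2 (hB v)) hw
    · rcases comp_vertex_cases v with ⟨v, rfl⟩ | ⟨v, rfl⟩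
      · exact (i1 v).2 (h2 h0 v)
      · exact (i2 v).2 (hB v)
    · obtain ⟨s, hs, hs'⟩ := h7 h0
      refine ⟨rightVertex A B h s, mt (o2 s).1 hs, fun w hw => ?_⟩
      rcases comp_vertex_cases w with ⟨v, rfl⟩ | ⟨v, rfl⟩
      · exact absurd ((o1 v).2 (hA v)) hw
      · rw [hs' v (mt (o2 v).2 hw)]
    · rcases comp_vertex_cases v with ⟨v, rfl⟩ | ⟨v, rfl⟩
      · exact (o1 v).2 (hA v)
      · exact (o2 v).2 (h8 h0 v)

theorem IsTwoTerminal.congr {A B : Slice T} (f : Iso A B) (H : A.IsTwoTerminal) :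
    B.IsTwoTerminal := by
  have i1 : ∀ v, _ ↔ _ := fun v => exists_mem_iff_of_bijOn (f.bijOn_in v)
  have o1 : ∀ v, _ ↔ _ := fun v => exists_mem_iff_of_bijOn (f.bijOn_out v)
  simp only [Set.mem_ofPred_eq] at i1 o1
  obtain ⟨h1, h2, h3, h4⟩ := H
  rw [f.hinn] at h1 h2
  rw [f.hout] at h3 h4
  unfold IsTwoTerminal
  simp only [f.onV.surjective.forall, i1, o1]
  refine ⟨fun h => ?_, h2, fun h => ?_, h4⟩
  · obtain ⟨v, hv, hv'⟩ := h1 h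
    refine ⟨f.onV v, mt (i1 v).1 hv, fun w hw => ?_⟩
    obtain ⟨w, rfl⟩ := f.onV.surjective w
    rw [hv' w (mt (i1 w).2 hw)]
  · obtain ⟨v, hv, hv'⟩ := h3 h
    refine ⟨f.onV v, mt (o1 v).1 hv, fun w hw => ?_⟩
    obtain ⟨w, rfl⟩ := f.onV.surjective w
    rw [hv' w (mt (o1 w).2 hw)]

end Slice

namespace Slice

/-! ### Unit slices -/

theorem IsUnitSlice.subsingleton {S : Slice T} (h : S.IsUnitSlice) : Subsingleton S.V := by
  obtain ⟨v, -, hv⟩ := h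
  exact ⟨fun a b => (hv a trivial).trans (hv b trivial).symm⟩

theorem IsUnitSlice.src_isLeft_or_tgt_isRight {S : Slice T} (h : S.IsUnitSlice) (e : S.E) :
    (∃ i, S.src e = Sum.inl i) ∨ ∃ j, S.tgt e = Sum.inr j := by
  have := h.subsingleton
  rcases hs : S.src e with i | v
  · exact Or.inl ⟨i, rfl⟩
  · rcases ht : S.tgt e with w | j
    · exact absurd (.single ⟨e, hs, by rw [ht, Subsingleton.elim w v]⟩) (S.acyclic v)
    · exact Or.inr ⟨j, rfl⟩

/-- With only one center vertex and no cycles, every edge entering that vertex comes from the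
in-frontier, and every edge leaving it goes to the out-frontier. -/
theorem IsUnitSlice.isNondegenerate {S : Slice T} (h : S.IsUnitSlice) (h2 : S.IsTwoTerminal) :
    S.IsNondegenerate := by
  have := h.subsingleton
  have v := S.nonemptyV.some
  constructor
  · intro h0
    obtain ⟨e, he⟩ := h2.2.1 h0 v
    rcases h.src_isLeft_or_tgt_isRight e with ⟨i, hi⟩ | ⟨j, hj⟩
    · rw [S.src_eq_inl] at hi
      exact ⟨i, v, hi ▸ he⟩
    · rw [hj] at he; cases he
  · intro h0
    obtain ⟨e, he⟩ := h2.2.2.2 h0 v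
    rcases h.src_isLeft_or_tgt_isRight e with ⟨i, hi⟩ | ⟨j, hj⟩
    · rw [hi] at he; cases he
    · rw [S.tgt_eq_inr] at hj
      exact ⟨j, v, hj ▸ he⟩

/-- The in-frontier edges are those into the center (`I`) and those passing by (`P`); the
out-frontier edges are those out of the center (`O`) and again `P`. Conservation at the only vertex
equates the totals over `I` and `O`. -/
theorem IsUnitSlice.total_out {S : Slice T} (h : S.IsUnitSlice) (h2 : S.IsTwoTerminal) {c : ℕ}
    {M : S.E → ℕ} (hM : S.IsFlow c M) (h0 : S.inn ≠ 0 → ∑ i, M (S.inEdge i) = c)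
    (h1 : S.out ≠ 0) : ∑ j, M (S.outEdge j) = c := by
  have := h.subsingleton
  have := S.finE
  obtain ⟨v⟩ := S.nonemptyV
  have hfin : ∀ s : Set S.E, s.Finite := fun s => s.toFinite
  set I : Set S.E := {e | S.tgt e = Sum.inl v} with hI
  set O : Set S.E := {e | S.src e = Sum.inr v} with hO
  set P : Set S.E := {e | (∃ i, S.src e = Sum.inl i) ∧ ∃ j, S.tgt e = Sum.inr j} with hP
  have hone : O.Nonempty := h2.2.2.2 h1 v
  have hin : ∑ i, M (S.inEdge i) = ∑ᶠ e ∈ I ∪ P, M e := by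
    rw [← finsum_eq_sum_of_fintype, ← finsum_mem_range (f := M) S.inEdge_injective]
    refine congrArg (fun s : Set S.E => ∑ᶠ e ∈ s, M e) (Set.ext fun e => ?_)
    · constructor
      · rintro ⟨i, rfl⟩
        rcases ht : S.tgt (S.inEdge i) with w | j
        · exact Or.inl (by rw [hI, Set.mem_ofPred_eq, ht, Subsingleton.elim w v])
        · exact Or.inr ⟨⟨i, by simp⟩, ⟨j, ht⟩⟩
      · rintro (he | ⟨⟨i, hi⟩, _⟩)
        · rcases h.src_isLeft_or_tgt_isRight e with ⟨i, hi⟩ | ⟨j, hj⟩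
          · exact ⟨i, ((S.src_eq_inl _ _).1 hi).symm⟩
          · rw [hI, Set.mem_ofPred_eq, hj] at he; cases he
        · exact ⟨i, ((S.src_eq_inl _ _).1 hi).symm⟩
  have hout : ∑ i, M (S.outEdge i) = ∑ᶠ e ∈ O ∪ P, M e := by
    rw [← finsum_eq_sum_of_fintype, ← finsum_mem_range (f := M) S.outEdge_injective]
    refine congrArg (fun s : Set S.E => ∑ᶠ e ∈ s, M e) (Set.ext fun e => ?_)
    · constructor
      · rintro ⟨i, rfl⟩
        rcases ht : S.src (S.outEdge i) with j | w
        · exact Or.inr ⟨⟨j, ht⟩, ⟨i, by simp⟩⟩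
        · exact Or.inl (by rw [hO, Set.mem_ofPred_eq, ht, Subsingleton.elim w v])
      · rintro (he | ⟨_, ⟨i, hi⟩⟩)
        · rcases h.src_isLeft_or_tgt_isRight e with ⟨i, hi⟩ | ⟨j, hj⟩
          · rw [hO, Set.mem_ofPred_eq, hi] at he; cases he
          · exact ⟨j, ((S.tgt_eq_inr _ _).1 hj).symm⟩
        · exact ⟨i, ((S.tgt_eq_inr _ _).1 hi).symm⟩
  have dI : Disjoint I P := by
    rw [Set.disjoint_left]
    rintro e he ⟨_, j, hj⟩
    rw [hI, Set.mem_ofPred_eq, hj] at he; cases he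
  have dO : Disjoint O P := by
    rw [Set.disjoint_left]
    rintro e he ⟨⟨j, hj⟩, _⟩
    rw [hO, Set.mem_ofPred_eq, hj] at he; cases he
  rw [finsum_mem_union dI (hfin _) (hfin _)] at hin
  rw [finsum_mem_union dO (hfin _) (hfin _)] at hout
  have hcons := hM.2 v
  rw [sumOr_of_nonempty hone] at hcons
  -- In an initial slice the center is the source, and the default value `c` of `sumOr` supplies the
  -- total.
  by_cases hn : S.inn = 0
  · have noleft : ∀ e i, S.src e ≠ Sum.inl i := fun e i => absurd i.2 (by omega)
    have eP : P = ∅ := by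
      rw [Set.eq_empty_iff_forall_notMem]
      rintro e ⟨⟨i, hi⟩, _⟩
      exact noleft e i hi
    have eI : I = ∅ := by
      rw [Set.eq_empty_iff_forall_notMem]
      intro e he
      rcases h.src_isLeft_or_tgt_isRight e with ⟨i, hi⟩ | ⟨j, hj⟩
      · exact noleft e i hi
      · rw [hI, Set.mem_ofPred_eq, hj] at he; cases he
    rw [← hI, eI, sumOr_empty] at hcons
    rw [hout, eP, ← hcons]
    simp
  · have hine : I.Nonempty := h2.2.1 hn v
    rw [sumOr_of_nonempty hine] at hcons
    rw [hout, ← h0 hn, hin, hcons]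

/-- Flows restrict to the factors and can be glued when they agree on the common frontier. That the
total there is `c` is not an extra condition: conservation carries it across the unit slice `A`. -/
theorem hasFlow_comp_iff {A B : Slice T} {h : A.out = B.inn} {c : ℕ} {m m'' : ℕ → ℕ}
    (hA : A.IsUnitSlice) (h2 : A.IsTwoTerminal) (hk : A.out ≠ 0) :
    (A.comp B h).HasFlow c m m'' ↔ ∃ m', A.HasFlow c m m' ∧ B.HasFlow c m' m'' := by
  constructor
  · rintro ⟨M, hM, h3, h4, h5, h6⟩
    rw [isFlow_comp_iff] at hM
    obtain ⟨m', hm'⟩ : ∃ m' : ℕ → ℕ, ∀ j : Fin A.out, M (leftEdge A B h (A.outEdge j)) = m' j :=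
      ⟨fun n => if hn : n < A.out then M (leftEdge A B h (A.outEdge ⟨n, hn⟩)) else 0,
        fun j => by dsimp only; rw [dif_pos j.2]⟩
    have tot : ∑ j : Fin A.out, m' j = c := by
      rw [← hA.total_out h2 hM.1 (fun h0 => ?_) hk]
      · exact Finset.sum_congr rfl fun j _ => (hm' j).symm
      · rw [← h5 h0]
        exact Finset.sum_congr rfl fun i _ => h3 i
    refine ⟨m', ⟨_, hM.1, fun i => h3 i, hm', h5, fun _ => tot⟩,
      ⟨_, hM.2, fun i => ?_, fun j => ?_, fun _ => ?_, h6⟩⟩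
    · rw [Function.comp_apply, rightEdge_inEdge, hm']; rfl
    · rw [Function.comp_apply, ← comp_outEdge]; exact h4 j
    · rw [sum_fin_eq h.symm, tot]
  · rintro ⟨m', ⟨M, hM, h3, h4, h5, h6⟩, ⟨N, hN, h7, h8, h9, h10⟩⟩
    obtain ⟨L, hL1, hL2⟩ : ∃ L : (A.comp B h).E → ℕ, L ∘ leftEdge A B h = M ∧
        L ∘ rightEdge A B h = N := by
      let L : (A.comp B h).E → ℕ := (Sum.elim M fun e => N e.1 :
        A.E ⊕ {e : B.E // (B.src e).isRight = true} → ℕ)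
      refine ⟨L, rfl, funext fun f => ?_⟩
      rcases hs : B.src f with i | v
      · obtain rfl := (B.src_eq_inl _ _).1 hs
        exact (congrArg L (rightEdge_inEdge A B h i)).trans ((h4 _).trans (h7 i).symm)
      · exact congrArg L (rightEdge_of_isRight A B h f (by rw [hs]; rfl))
    refine ⟨L, isFlow_comp_iff.2 ⟨hL1 ▸ hM, hL2 ▸ hN⟩, fun i => ?_, fun j => ?_, h5, h10⟩
    · rw [← hL1] at h3
      exact h3 i
    · rw [← hL2] at h8
      have := comp_outEdge A B h j
      refine Eq.trans (congrArg L this) (h8 j)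

/-! ### Runs -/

/-- The slice `S` leads from the data `ρ`, `m` at its in-frontier to `ρ'`, `m'` at its
out-frontier. -/
def IsStep (c : ℕ) (S : Slice T) (ρ : ℕ → ℕ → Prop) (m : ℕ → ℕ) (ρ' : ℕ → ℕ → Prop)
    (m' : ℕ → ℕ) : Prop :=
  S.Reduced ρ ∧ S.Transfers ρ ρ' ∧ S.HasFlow c m m' ∧ S.IsTwoTerminal

/-- The slice `H` can complete a prefix with data `ρ`, `m`. -/
def IsGood (c : ℕ) (H : Slice T) (ρ : ℕ → ℕ → Prop) (m : ℕ → ℕ) : Prop :=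
  H.Reduced ρ ∧ (∃ m', H.HasFlow c m m') ∧ H.IsTwoTerminal

/-- The word of slices can be read from the data `ρ`, `m` on. -/
inductive Run (c : ℕ) : List (Slice T) → (ℕ → ℕ → Prop) → (ℕ → ℕ) → Prop
  | single {S ρ m ρ' m'} : IsStep c S ρ m ρ' m' → S.out = 0 → Run c [S] ρ m
  | cons {S S' w ρ m ρ' m'} : IsStep c S ρ m ρ' m' → S.out ≠ 0 → S.out = S'.inn →
      Run c (S' :: w) ρ' m' → Run c (S :: S' :: w) ρ m

theorem IsStep.congr {c : ℕ} {A B : Slice T} {ρ ρ' : ℕ → ℕ → Prop} {m m' : ℕ → ℕ} (f : Iso A B)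
    (H : IsStep c A ρ m ρ' m') : IsStep c B ρ m ρ' m' :=
  ⟨H.1.congr f, H.2.1.congr f, H.2.2.1.congr f, H.2.2.2.congr f⟩

theorem IsGood.congr {c : ℕ} {A B : Slice T} {ρ : ℕ → ℕ → Prop} {m : ℕ → ℕ} (f : Iso A B)
    (H : IsGood c A ρ m) : IsGood c B ρ m :=
  ⟨H.1.congr f, H.2.1.imp fun _ h => h.congr f, H.2.2.congr f⟩

theorem isGood_iff_isStep {c : ℕ} {S : Slice T} {ρ : ℕ → ℕ → Prop} {m : ℕ → ℕ} :
    IsGood c S ρ m ↔ ∃ ρ' m', IsStep c S ρ m ρ' m' := by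
  obtain ⟨ρ', hρ'⟩ := S.exists_transfers ρ
  exact ⟨fun ⟨h1, ⟨m', h2⟩, h3⟩ => ⟨ρ', m', h1, hρ', h2, h3⟩,
    fun ⟨_, m', h1, _, h2, h3⟩ => ⟨h1, ⟨m', h2⟩, h3⟩⟩

theorem isGood_comp_iff {c : ℕ} {A B : Slice T} {h : A.out = B.inn} (hA : A.IsUnitSlice)
    {ρ : ℕ → ℕ → Prop} {m : ℕ → ℕ} :
    IsGood c (A.comp B h) ρ m ↔
      A.out ≠ 0 ∧ ∃ ρ' m', IsStep c A ρ m ρ' m' ∧ IsGood c B ρ' m' := by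
  constructor
  · rintro ⟨h1, ⟨m'', h2⟩, h3⟩
    obtain ⟨hk, h4, h5⟩ := isTwoTerminal_comp_iff.1 h3
    obtain ⟨m', h6, h7⟩ := (hasFlow_comp_iff hA h4 hk).1 h2
    obtain ⟨ρ', hρ'⟩ := A.exists_transfers ρ
    obtain ⟨h8, h9⟩ := (reduced_comp_iff hρ').1 h1
    exact ⟨hk, ρ', m', ⟨h8, hρ', h6, h4⟩, h9, ⟨m'', h7⟩, h5⟩
  · rintro ⟨hk, ρ', m', ⟨h1, h2, h3, h4⟩, h5, ⟨m'', h6⟩, h7⟩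
    exact ⟨(reduced_comp_iff h2).2 ⟨h1, h5⟩, ⟨m'', (hasFlow_comp_iff hA h4 hk).2 ⟨m', h3, h6⟩⟩,
      isTwoTerminal_comp_iff.2 ⟨hk, h4, h7⟩⟩

theorem Composes.exists_cons {w : List (Slice T)} {H : Slice T} (hw : Composes w H) :
    ∃ S w', w = S :: w' ∧ S.inn = H.inn := by
  cases hw with
  | single hS => exact ⟨_, _, rfl, hS.some.hinn⟩
  | cons h hK hS => exact ⟨_, _, rfl, hS.some.hinn⟩

/-- Goodness splits off one unit slice at a time (`isGood_comp_iff`). Since the left side does not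
mention `w`, either all unit decompositions of `H` can be read or none can; this is the source of
saturation. -/
theorem Composes.isGood_iff_run {c : ℕ} {w : List (Slice T)} {H : Slice T} (hw : Composes w H)
    (hunit : ∀ S ∈ w, S.IsUnitSlice) (hout : H.out = 0) (ρ : ℕ → ℕ → Prop) (m : ℕ → ℕ) :
    IsGood c H ρ m ↔ Run c w ρ m := by
  induction hw generalizing ρ m with
  | @single S H hS =>
    obtain ⟨f⟩ := hS
    have h1 : IsGood c H ρ m ↔ IsGood c S ρ m := ⟨fun h => h.congr f.symm, fun h => h.congr f⟩
    rw [h1, isGood_iff_isStep]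
    constructor
    · rintro ⟨ρ', m', h⟩
      exact .single h (f.hout.trans hout)
    · rintro (⟨h, -⟩ | _)
      exact ⟨_, _, h⟩
  | @cons S K H w h hK hS ih =>
    obtain ⟨f⟩ := hS
    have h1 : IsGood c H ρ m ↔ IsGood c (S.comp K h) ρ m :=
      ⟨fun h => h.congr f.symm, fun h => h.congr f⟩
    obtain ⟨S', w', rfl, hS'⟩ := hK.exists_cons
    have ih := ih (fun S hS => hunit S (List.mem_cons_of_mem _ hS)) (f.hout.trans hout)
    rw [h1, isGood_comp_iff (hunit S List.mem_cons_self)]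
    constructor
    · rintro ⟨hk, ρ', m', hstep, hg⟩
      exact .cons hstep hk (h.trans hS'.symm) ((ih _ _).1 hg)
    · rintro (_ | ⟨hstep, hk, -, hr⟩)
      exact ⟨hk, _, _, hstep, (ih _ _).2 hr⟩

theorem Composes.out_eq_zero_of_run {c : ℕ} {w : List (Slice T)} {H : Slice T}
    (hw : Composes w H) {ρ : ℕ → ℕ → Prop} {m : ℕ → ℕ} (hr : Run c w ρ m) : H.out = 0 := by
  induction hw generalizing ρ m with
  | single hS =>
    obtain ⟨f⟩ := hS
    rcases hr with ⟨-, h⟩ | _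
    exact f.hout.symm.trans h
  | cons h hK hS ih =>
    obtain ⟨f⟩ := hS
    rcases hr with _ | ⟨-, -, -, hr⟩
    · cases hK
    · exact f.hout.symm.trans (ih hr)

theorem Run.width_le {c : ℕ} {w : List (Slice T)} {ρ : ℕ → ℕ → Prop} {m : ℕ → ℕ}
    (hr : Run c w ρ m) : ∀ S ∈ w, S.width ≤ c := by
  have step : ∀ {S : Slice T} {ρ m ρ' m'}, IsStep c S ρ m ρ' m' → S.width ≤ c :=
    fun h => max_le h.2.2.1.inn_le h.2.2.1.out_le
  induction hr with
  | single h _ => simpa using step h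
  | cons h _ _ _ ih =>
    intro S hS
    rcases List.mem_cons.1 hS with rfl | hS
    exacts [step h, ih S hS]

end Slice

/-! ### Unit slices up to isomorphism -/

namespace Slice

theorem IsUnitSlice.edge_ext {S : Slice T} (h : S.IsUnitSlice) {e e' : S.E}
    (hs : S.src e = S.src e') (ht : S.tgt e = S.tgt e') : e = e' := by
  rcases h.src_isLeft_or_tgt_isRight e with ⟨i, hi⟩ | ⟨j, hj⟩
  · rw [(S.src_eq_inl _ _).1 hi, (S.src_eq_inl _ _).1 (hs.symm.trans hi)]
  · rw [(S.tgt_eq_inr _ _).1 hj, (S.tgt_eq_inr _ _).1 (ht.symm.trans hj)]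

/-- The edge of `B` that corresponds to an edge of `A`, if these unit slices agree. -/
theorem IsUnitSlice.exists_edge {A B : Slice T} (hA : A.IsUnitSlice) (hB : B.IsUnitSlice)
    (hinn : A.inn = B.inn) (hout : A.out = B.out) (f : A.V → B.V)
    (hpass : ∀ i j, A.inEdge i = A.outEdge j ↔
      B.inEdge (Fin.cast hinn i) = B.outEdge (Fin.cast hout j)) (e : A.E) :
    ∃ e', B.src e' = Sum.map (Fin.cast hinn) f (A.src e) ∧
      B.tgt e' = Sum.map f (Fin.cast hout) (A.tgt e) := by
  have := hB.subsingleton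
  rcases hs : A.src e with i | v <;> rcases ht : A.tgt e with w | j
  · obtain rfl := (A.src_eq_inl _ _).1 hs
    refine ⟨B.inEdge (Fin.cast hinn i), by simp, ?_⟩
    rcases ht' : B.tgt (B.inEdge (Fin.cast hinn i)) with w' | j'
    · simp [Subsingleton.elim w' (f w)]
    · rw [B.tgt_eq_inr] at ht'
      rw [(hpass i (Fin.cast hout.symm j')).2 (by simpa using ht'), tgt_outEdge] at ht
      cases ht
  · obtain rfl := (A.src_eq_inl _ _).1 hs
    rw [A.tgt_eq_inr] at ht
    exact ⟨B.inEdge (Fin.cast hinn i), by simp, by simp [(hpass i j).1 ht]⟩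
  · rcases hA.src_isLeft_or_tgt_isRight e with ⟨i, hi⟩ | ⟨j, hj⟩
    · rw [hi] at hs; cases hs
    · rw [hj] at ht; cases ht
  · obtain rfl := (A.tgt_eq_inr _ _).1 ht
    refine ⟨B.outEdge (Fin.cast hout j), ?_, by simp⟩
    rcases hs' : B.src (B.outEdge (Fin.cast hout j)) with i' | w'
    · rw [B.src_eq_inl] at hs'
      rw [← (hpass (Fin.cast hinn.symm i') j).2 (by simpa using hs'.symm), src_inEdge] at hs
      cases hs
    · simp [Subsingleton.elim w' (f v)]

/-- Every edge of a unit slice touches a frontier. Once it is known which edges pass from frontier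
to frontier, all the others must be attached to the single center vertex, so finitely many bits
determine the slice. -/
theorem IsUnitSlice.nonempty_iso {A B : Slice T} (hA : A.IsUnitSlice) (hB : B.IsUnitSlice)
    (hinn : A.inn = B.inn) (hout : A.out = B.out) (hlabel : ∀ v w, A.label v = B.label w)
    (hpass : ∀ i j, A.inEdge i = A.outEdge j ↔
      B.inEdge (Fin.cast hinn i) = B.outEdge (Fin.cast hout j)) : Nonempty (Iso A B) := by
  have := hA.subsingleton
  have := hB.subsingleton
  obtain ⟨a⟩ := A.nonemptyV
  obtain ⟨b⟩ := B.nonemptyV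
  let φ : A.V ≃ B.V := ⟨fun _ => b, fun _ => a, fun _ => Subsingleton.elim _ _,
    fun _ => Subsingleton.elim _ _⟩
  choose F hF1 hF2 using hA.exists_edge hB hinn hout φ hpass
  choose G hG1 hG2 using hB.exists_edge hA hinn.symm hout.symm φ.symm
    (fun i j => by rw [hpass]; rfl)
  refine ⟨⟨hinn, hout, φ, ⟨F, G, fun e => hA.edge_ext ?_ ?_, fun e => hB.edge_ext ?_ ?_⟩,
    fun v => (hlabel _ _).symm, hF1, hF2⟩⟩
  · rw [hG1, hF1]; cases A.src e <;> simp
  · rw [hG2, hF2]; cases A.tgt e <;> simp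
  · rw [hF1, hG1]; cases B.src e <;> simp
  · rw [hF2, hG2]; cases B.tgt e <;> simp

/-- Only the entries below the frontier sizes matter, which allows the data on `ℕ` to be replaced by
finite data on `Fin c`. -/
theorem IsStep.of_eq {c : ℕ} {S : Slice T} {ρ ρ' σ σ' : ℕ → ℕ → Prop} {m m' n n' : ℕ → ℕ}
    (h : IsStep c S ρ m ρ' m') (hρ : ∀ i j : Fin S.inn, ρ i j ↔ σ i j)
    (hm : ∀ i : Fin S.inn, m i = n i) (hρ' : ∀ i j : Fin S.out, ρ' i j ↔ σ' i j)
    (hm' : ∀ i : Fin S.out, m' i = n' i) : IsStep c S σ n σ' n' := by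
  have : S.BelowStep ρ = S.BelowStep σ := by
    unfold BelowStep
    simp only [hρ]
  obtain ⟨h1, h2, h3, h4⟩ := h
  unfold IsStep Reduced Transfers HasFlow Below at *
  rw [← this]
  simp only [← hρ', ← hm, ← hm']
  exact ⟨h1, h2, h3, h4⟩

end Slice

open Slice

/-! ### The generator -/

/-- The data of a unit slice of width at most `c`, together with the data at its frontiers. -/
structure GeneratorState (c n : ℕ) where
  inn : Fin (c + 1)
  out : Fin (c + 1)
  lab : Fin n
  pass : Fin c → Fin c → Prop
  know : Fin c → Fin c → Prop
  know' : Fin c → Fin c → Prop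
  flow : Fin c → Fin (c + 1)
  flow' : Fin c → Fin (c + 1)

namespace GeneratorState

variable {c n : ℕ}

/-- A state as a tuple. -/
def toTuple (x : GeneratorState c n) : Fin n × (Fin (c + 1) × Fin (c + 1)) ×
    ((Fin c → Fin c → Prop) × (Fin c → Fin c → Prop) × (Fin c → Fin c → Prop)) ×
    (Fin c → Fin (c + 1)) × (Fin c → Fin (c + 1)) :=
  (x.lab, (x.inn, x.out), (x.pass, x.know, x.know'), x.flow, x.flow')

theorem toTuple_injective : Function.Injective (toTuple (c := c) (n := n)) := by
  rintro ⟨⟩ ⟨⟩ h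
  simp only [toTuple, Prod.mk.injEq] at h
  obtain ⟨rfl, ⟨rfl, rfl⟩, ⟨rfl, rfl, rfl⟩, rfl, rfl⟩ := h
  rfl

instance : Finite (GeneratorState c n) := Finite.of_injective _ toTuple_injective

/-- Besides the label there are seven components: two sizes, three relations and two flows. Each
takes at most `2 ^ (c ^ 2)` values; for the sizes this uses `1 ≤ c`. -/
theorem natCard_le (hc : 1 ≤ c) : Nat.card (GeneratorState c n) ≤ n * 2 ^ (7 * c ^ 2) := by
  refine (Nat.card_le_card_of_injective _ toTuple_injective).trans ?_
  have hProp : Nat.card Prop = 2 := by rw [Nat.card_eq_fintype_card, Fintype.card_prop]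
  simp only [Nat.card_prod, Nat.card_fun, Nat.card_fin, hProp]
  refine Nat.mul_le_mul_left _ ?_
  have h : c + 1 ≤ 2 ^ c := Nat.lt_two_pow_self
  have h2 : (c + 1) ^ c ≤ 2 ^ (c ^ 2) := by
    calc (c + 1) ^ c ≤ (2 ^ c) ^ c := Nat.pow_le_pow_left h c
      _ = 2 ^ (c ^ 2) := by rw [← pow_mul, sq]
  have h3 : ((2 : ℕ) ^ c) ^ c = 2 ^ (c ^ 2) := by rw [← pow_mul, sq]
  have h4 : c + 1 ≤ 2 ^ (c ^ 2) := h.trans (Nat.pow_le_pow_right (by norm_num) (by nlinarith))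
  rw [h3]
  calc _ ≤ 2 ^ (c ^ 2) * 2 ^ (c ^ 2) * (2 ^ (c ^ 2) * (2 ^ (c ^ 2) * 2 ^ (c ^ 2)) *
        (2 ^ (c ^ 2) * 2 ^ (c ^ 2))) := by gcongr
    _ = 2 ^ (7 * c ^ 2) := by ring

end GeneratorState

/-- Extension of a relation by `False`. -/
def extendRel {c : ℕ} (r : Fin c → Fin c → Prop) (i j : ℕ) : Prop :=
  ∃ (hi : i < c) (hj : j < c), r ⟨i, hi⟩ ⟨j, hj⟩

/-- Extension of a function by zero. -/
def extendFun {c : ℕ} (f : Fin c → Fin (c + 1)) (i : ℕ) : ℕ :=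
  if hi : i < c then f ⟨i, hi⟩ else 0

/-- Restriction of a relation. -/
def restrictRel (c : ℕ) (r : ℕ → ℕ → Prop) (i j : Fin c) : Prop := r i j

/-- Restriction of a function, truncated at `c`. -/
def restrictFun (c : ℕ) (f : ℕ → ℕ) (i : Fin c) : Fin (c + 1) :=
  ⟨min (f i) c, Nat.lt_succ_of_le (min_le_right _ _)⟩

theorem extendRel_restrictRel {c : ℕ} {r : ℕ → ℕ → Prop} {i j : ℕ} (hi : i < c) (hj : j < c) :
    r i j ↔ extendRel (restrictRel c r) i j :=
  ⟨fun h => ⟨hi, hj, h⟩, fun ⟨_, _, h⟩ => h⟩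

theorem extendFun_restrictFun {c : ℕ} {f : ℕ → ℕ} {i : ℕ} (hi : i < c) (hf : f i ≤ c) :
    f i = extendFun (restrictFun c f) i := by
  simp [extendFun, restrictFun, hi, hf]

namespace GeneratorState

variable {c n : ℕ} {e : T ≃ Fin n}

/-- The unit slice `S` fits the state `x`. -/
structure Realizes (e : T ≃ Fin n) (x : GeneratorState c n) (S : Slice T) : Prop where
  isUnitSlice : S.IsUnitSlice
  inn_eq : S.inn = x.inn
  out_eq : S.out = x.out
  label_eq : ∀ v, e (S.label v) = x.lab
  pass_iff : ∀ (i : Fin S.inn) (j : Fin S.out), extendRel x.pass i j ↔ S.inEdge i = S.outEdge j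
  isStep : IsStep c S (extendRel x.know) (extendFun x.flow) (extendRel x.know')
    (extendFun x.flow')

theorem Realizes.nonempty_iso {x : GeneratorState c n} {A B : Slice T} (hA : x.Realizes e A)
    (hB : x.Realizes e B) : Nonempty (Iso A B) :=
  hA.isUnitSlice.nonempty_iso hB.isUnitSlice (hA.inn_eq.trans hB.inn_eq.symm)
    (hA.out_eq.trans hB.out_eq.symm)
    (fun v w => e.injective ((hA.label_eq v).trans (hB.label_eq w).symm))
    (fun i j => by rw [← hA.pass_iff, ← hB.pass_iff]; rfl)

theorem exists_realizes (e : T ≃ Fin n) {S : Slice T} (hS : S.IsUnitSlice) {ρ ρ' : ℕ → ℕ → Prop}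
    {m m' : ℕ → ℕ} (h : IsStep c S ρ m ρ' m') :
    ∃ x : GeneratorState c n, x.Realizes e S ∧ x.know = restrictRel c ρ ∧
      x.know' = restrictRel c ρ' ∧ x.flow = restrictFun c m ∧ x.flow' = restrictFun c m' := by
  have hin := h.2.2.1.inn_le
  have hout := h.2.2.1.out_le
  obtain ⟨v⟩ := S.nonemptyV
  have := hS.subsingleton
  refine ⟨⟨⟨S.inn, by omega⟩, ⟨S.out, by omega⟩, e (S.label v),
    fun i j => ∃ (hi : i < S.inn) (hj : j < S.out), S.inEdge ⟨i, hi⟩ = S.outEdge ⟨j, hj⟩,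
    _, _, _, _⟩, ⟨hS, rfl, rfl, fun w => by rw [Subsingleton.elim w v], fun i j => ?_, ?_⟩,
    rfl, rfl, rfl, rfl⟩
  · exact ⟨fun ⟨_, _, _, _, h⟩ => h, fun h => ⟨by omega, by omega, i.2, j.2, h⟩⟩
  · refine h.of_eq (fun i j => ?_) (fun i => ?_) (fun i j => ?_) (fun i => ?_)
    · exact extendRel_restrictRel (by omega) (by omega)
    -- Truncation at `c` loses nothing, since a single value is at most the total.
    · exact extendFun_restrictFun (by omega) (h.2.2.1.le_of_inn i)
    · exact extendRel_restrictRel (by omega) (by omega)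
    · exact extendFun_restrictFun (by omega) (h.2.2.1.le_of_out i)

end GeneratorState

/-- The saturated generator for slice width `c`: its vertices are the states realized by some unit
slice, and adjacent states agree on the data at the common frontier. -/
noncomputable def generator (c : ℕ) {n : ℕ} (e : T ≃ Fin n) : SliceGraph T where
  V := {x : GeneratorState c n // ∃ S : Slice T, x.Realizes e S}
  finV := inferInstance
  -- The condition `out ≠ 0` prevents a walk from continuing after a final slice, which would
  -- compose disconnected DAGs.
  Adj x y := x.1.out.1 ≠ 0 ∧ x.1.out = y.1.inn ∧ x.1.know' = y.1.know ∧ x.1.flow' = y.1.flow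
  -- The choice is immaterial: by `Realizes.nonempty_iso` a state determines its slice up to
  -- isomorphism.
  slice x := x.2.choose
  isUnit x := x.2.choose_spec.isUnitSlice
  isNondegenerate x := x.2.choose_spec.isUnitSlice.isNondegenerate x.2.choose_spec.isStep.2.2.2
  composable x y h := by
    rw [x.2.choose_spec.out_eq, y.2.choose_spec.inn_eq, h.2.1]

/-! ### The languages of the generator, and saturation -/

section Language

variable {c n : ℕ} {e : T ≃ Fin n}

theorem generator_realizes (x : (generator c e).V) : x.1.Realizes e ((generator c e).slice x) :=
  x.2.choose_spec

theorem exists_vertex {S : Slice T} (hS : S.IsUnitSlice) {ρ ρ' : ℕ → ℕ → Prop}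
    {m m' : ℕ → ℕ} (h : IsStep c S ρ m ρ' m') :
    ∃ x : (generator c e).V, x.1.Realizes e S ∧ x.1.know = restrictRel c ρ ∧
      x.1.know' = restrictRel c ρ' ∧ x.1.flow = restrictFun c m ∧
      x.1.flow' = restrictFun c m' := by
  obtain ⟨x, hx, h⟩ := GeneratorState.exists_realizes e hS h
  exact ⟨⟨x, S, hx⟩, hx, h⟩

theorem run_of_walk (p : List (generator c e).V) (x : (generator c e).V) (w : List (Slice T))
    (hp : (x :: p).IsChain (generator c e).Adj)
    (hlast : ∀ v ∈ (x :: p).getLast?, ((generator c e).slice v).IsFinal)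
    (hw : List.Forall₂ (fun S S' => Nonempty (Iso S S')) w ((x :: p).map (generator c e).slice)) :
    Run c w (extendRel x.1.know) (extendFun x.1.flow) ∧ ∀ S ∈ w, S.IsUnitSlice := by
  induction p generalizing x w with
  | nil =>
    rcases hw with _ | @⟨S, _, w, _, ⟨f⟩, hw⟩
    cases hw
    have hx := generator_realizes x
    refine ⟨.single (hx.isStep.congr f.symm) (f.hout.trans (hlast x rfl)), ?_⟩
    simpa using f.symm.isUnitSlice hx.isUnitSlice
  | cons y p ih =>
    rcases hw with _ | @⟨S, _, w, _, ⟨f⟩, hw⟩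
    have hx := generator_realizes x
    have hy := generator_realizes y
    rw [List.isChain_cons_cons] at hp
    obtain ⟨hrun, hun⟩ := ih y w hp.2 (by simpa using hlast) hw
    rcases hw with _ | @⟨S', _, w, _, ⟨g⟩, hw⟩
    obtain ⟨h1, h2, h3, h4⟩ := hp.1
    refine ⟨.cons (hx.isStep.congr f.symm) ?_ ?_ (by rwa [h3, h4]), ?_⟩
    · rw [f.hout, hx.out_eq]; exact h1
    · rw [f.hout, hx.out_eq, g.hinn, hy.inn_eq, h2]
    · intro R hR
      rcases List.mem_cons.1 hR with rfl | hR
      exacts [f.symm.isUnitSlice hx.isUnitSlice, hun R hR]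

/-- The annotations of each state are the restrictions of the data of the run. Prescribing them
exactly at the first state is what makes the induction work: both neighbours at a frontier then
carry the restriction of the same data. -/
theorem exists_walk_of_run {w : List (Slice T)} {ρ : ℕ → ℕ → Prop} {m : ℕ → ℕ}
    (hr : Run c w ρ m) (hw : ∀ S ∈ w, S.IsUnitSlice) :
    ∃ (x : (generator c e).V) (p : List (generator c e).V),
      x.1.know = restrictRel c ρ ∧ x.1.flow = restrictFun c m ∧
      (x :: p).IsChain (generator c e).Adj ∧
      (∀ v ∈ (x :: p).getLast?, ((generator c e).slice v).IsFinal) ∧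
      List.Forall₂ (fun S S' => Nonempty (Iso S S')) w ((x :: p).map (generator c e).slice) := by
  induction hr with
  | single hS h0 =>
    obtain ⟨x, hx, h1, -, h2, -⟩ := exists_vertex (e := e) (hw _ List.mem_cons_self) hS
    refine ⟨x, [], h1, h2, by simp, ?_, ?_⟩
    · have hy := generator_realizes x
      simp only [List.getLast?_singleton, Option.mem_def, Option.some.injEq, forall_eq']
      exact hy.out_eq.trans (hx.out_eq.symm.trans h0)
    · exact .cons (hx.nonempty_iso (generator_realizes x)) .nil
  | cons hS hk hc hr ih =>
    obtain ⟨x, hx, h1, h1', h2, h2'⟩ := exists_vertex (e := e) (hw _ List.mem_cons_self) hS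
    obtain ⟨y, p, h3, h4, h5, h6, h7⟩ := ih fun S hS => hw S (List.mem_cons_of_mem _ hS)
    refine ⟨x, y :: p, h1, h2, ?_, by simpa using h6,
      .cons (hx.nonempty_iso (generator_realizes x)) h7⟩
    rw [List.isChain_cons_cons]
    refine ⟨⟨?_, ?_, h1'.trans h3.symm, h2'.trans h4.symm⟩, h5⟩
    · rw [← hx.out_eq]; exact hk
    · rcases h7 with _ | ⟨⟨g⟩, -⟩
      ext
      rw [← hx.out_eq, hc, g.hinn, (generator_realizes y).inn_eq]

theorem mem_sliceLanguage_iff {w : List (Slice T)} :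
    w ∈ (generator c e).sliceLanguage ↔
      (∀ S ∈ w, S.IsUnitSlice) ∧ (∀ S ∈ w.head?, S.inn = 0) ∧ ∃ ρ m, Run c w ρ m := by
  constructor
  · rintro ⟨p, hne, hp, hhead, hlast, hw⟩
    obtain ⟨x, p, rfl⟩ := List.exists_cons_of_ne_nil hne
    obtain ⟨h1, h2⟩ := run_of_walk p x w hp hlast hw
    refine ⟨h2, ?_, _, _, h1⟩
    rcases hw with _ | ⟨⟨f⟩, -⟩
    simp only [List.head?_cons, Option.mem_def, Option.some.injEq, forall_eq'] at hhead ⊢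
    exact f.hinn.trans hhead
  · rintro ⟨h1, h2, ρ, m, hr⟩
    obtain ⟨x, p, -, -, h3, h4, h5⟩ := exists_walk_of_run (e := e) hr h1
    refine ⟨x :: p, by simp, h3, ?_, h4, h5⟩
    rcases h5 with _ | ⟨⟨f⟩, -⟩
    simp only [List.head?_cons, Option.mem_def, Option.some.injEq, forall_eq'] at h2 ⊢
    exact f.hinn.symm.trans h2

/-- Membership becomes an intrinsic property of `H`, apart from the mere existence of a unit
decomposition. -/
theorem mem_graphLanguage_iff {H : Slice T} :
    H ∈ (generator c e).graphLanguage ↔ H.inn = 0 ∧ H.out = 0 ∧ (∃ ρ m, IsGood c H ρ m) ∧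
      H.unitDecompositions.Nonempty := by
  constructor
  · rintro ⟨w, hw, hH⟩
    obtain ⟨h1, h2, ρ, m, hr⟩ := mem_sliceLanguage_iff.1 hw
    have hout := hH.out_eq_zero_of_run hr
    obtain ⟨S, w', rfl, hS⟩ := hH.exists_cons
    exact ⟨hS.symm.trans (h2 S rfl), hout, ⟨ρ, m, (hH.isGood_iff_run h1 hout ρ m).2 hr⟩, _, h1, hH⟩
  · rintro ⟨hinn, hout, ⟨ρ, m, hg⟩, w, h1, hH⟩
    refine ⟨w, mem_sliceLanguage_iff.2 ⟨h1, ?_, ρ, m, (hH.isGood_iff_run h1 hout ρ m).1 hg⟩, hH⟩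
    obtain ⟨S, w', rfl, hS⟩ := hH.exists_cons
    simpa using hS.trans hinn

theorem isSaturated_generator : (generator c e).IsSaturated := by
  intro H hH w hw
  obtain ⟨hinn, hout, ⟨ρ, m, hg⟩, -⟩ := mem_graphLanguage_iff.1 hH
  refine mem_sliceLanguage_iff.2 ⟨hw.1, ?_, ρ, m, (hw.2.isGood_iff_run hw.1 hout ρ m).1 hg⟩
  obtain ⟨S, w', rfl, hS⟩ := hw.2.exists_cons
  simpa using hS.trans hinn

end Language

namespace Slice

/-! ### Slices without frontiers -/

theorem exists_src_eq_inr {H : Slice T} (h : H.inn = 0) (e : H.E) : ∃ v, H.src e = Sum.inr v := by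
  rcases hs : H.src e with i | v
  · have := i.2; omega
  · exact ⟨v, rfl⟩

theorem exists_tgt_eq_inl {H : Slice T} (h : H.out = 0) (e : H.E) : ∃ v, H.tgt e = Sum.inl v := by
  rcases hs : H.tgt e with v | i
  · exact ⟨v, rfl⟩
  · have := i.2; omega

theorem below_inr_iff {H : Slice T} (h : H.inn = 0) {ρ : ℕ → ℕ → Prop} {u v : H.V} :
    H.Below ρ (Sum.inr u) (Sum.inr v) ↔ ReflTransGen H.Adj u v := by
  constructor
  · intro huv
    suffices hs : ∀ z, H.Below ρ (Sum.inr u) z → ∀ v, z = Sum.inr v → ReflTransGen H.Adj u v from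
      hs _ huv _ rfl
    intro z hz
    induction hz with
    | refl => rintro v ⟨⟩; exact .refl
    | tail _ hstep ih =>
      rintro v rfl
      rcases hstep with ⟨i, -⟩ | ⟨e, w, rfl, hw, hv⟩
      · have := i.2; omega
      · cases hv
        obtain ⟨x, hx⟩ := exists_src_eq_inr h e
        exact (ih x hx).tail ⟨e, hx, hw⟩
  · intro huv
    induction huv with
    | refl => exact .refl
    | tail _ hstep ih =>
      obtain ⟨e, h1, h2⟩ := hstep
      exact ih.tail (Or.inr ⟨e, _, h1, h2, rfl⟩)

theorem reduced_iff {H : Slice T} (h : H.inn = 0) {ρ : ℕ → ℕ → Prop} :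
    H.Reduced ρ ↔ ∀ e e' u u' v, H.src e = Sum.inr u → H.src e' = Sum.inr u' →
      H.tgt e = Sum.inl v → H.tgt e' = Sum.inl v → ReflTransGen H.Adj u u' → e = e' := by
  constructor
  · intro hr e e' u u' v hu hu' hv hv' huu'
    refine hr e e' v hv hv' ?_
    rwa [hu, hu', below_inr_iff h]
  · intro hr e e' v hv hv' hb
    obtain ⟨u, hu⟩ := exists_src_eq_inr h e
    obtain ⟨u', hu'⟩ := exists_src_eq_inr h e'
    rw [hu, hu', below_inr_iff h] at hb
    exact hr e e' u u' v hu hu' hv hv' hb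

/-- If an edge were superfluous, a path avoiding it would join its ends; the last edge of that path
has the same target and a source reachable from the source of the deleted edge, against reducedness.
Parallel edges are excluded because reachability is reflexive. -/
theorem Reduced.isTransitiveReduced {H : Slice T} (hin : H.inn = 0) (hout : H.out = 0)
    {ρ : ℕ → ℕ → Prop} (hr : H.Reduced ρ) : H.IsTransitiveReduced := by
  rw [reduced_iff hin] at hr
  constructor
  · intro e e' hs ht
    obtain ⟨u, hu⟩ := exists_src_eq_inr hin e
    obtain ⟨v, hv⟩ := exists_tgt_eq_inl hout e
    exact hr e e' u u v hu (hs ▸ hu) hv (ht ▸ hv) .refl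
  · intro e he
    obtain ⟨u, hu⟩ := exists_src_eq_inr hin e
    obtain ⟨v, hv⟩ := exists_tgt_eq_inl hout e
    obtain ⟨u', h1, e', hne, hu', hv'⟩ := TransGen.tail'_iff.1 ((he u v).1 (.single ⟨e, hu, hv⟩))
    refine hne (hr e e' u u' v hu hu' hv hv' ?_).symm
    exact ReflTransGen.mono (fun a b ⟨e', _, h2, h3⟩ => ⟨e', h2, h3⟩) _ _ h1

/-- Edges of a reduced DAG are covering pairs of its closure, and a covering pair, being joined by a
path, must be joined by a path of length one. -/
theorem nonempty_iso_hasse {H : Slice T} (hin : H.inn = 0) (hout : H.out = 0)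
    {ρ : ℕ → ℕ → Prop} (hr : H.Reduced ρ) {P : LabelledPoset T} (hP : P.IsClosureOf H) :
    Nonempty (Iso H P.hasse) := by
  rw [reduced_iff hin] at hr
  obtain ⟨f, hf1, hf2⟩ := hP
  choose s hs using exists_src_eq_inr (H := H) hin
  choose t ht using exists_tgt_eq_inl (H := H) hout
  have hcov : ∀ e, f (s e) ⋖ f (t e) := by
    refine fun e => ⟨(hf2 _ _).1 (.single ⟨e, hs e, ht e⟩), fun w h1 h2 => ?_⟩
    obtain ⟨x, rfl⟩ := f.surjective w
    rw [← hf2] at h1 h2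
    -- An element strictly between the ends of `e` yields a path whose last edge `e'` must be `e`
    -- itself by reducedness; the path then returns to the source of `e`.
    obtain ⟨u', h3, e', hu', hv'⟩ := TransGen.tail'_iff.1 h2
    have := hr e e' _ u' _ (hs e) hu' (ht e) hv' (h1.to_reflTransGen.trans h3)
    subst this
    rw [hs, Sum.inr.injEq] at hu'
    subst hu'
    exact H.acyclic _ (TransGen.trans_left h1 h3)
  let F : H.E → P.hasse.E := fun e => ⟨(f (s e), f (t e)), hcov e⟩
  have hF : Function.Bijective F := by
    constructor
    · intro e e' hee
      have h1 : s e = s e' := f.injective (congrArg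
        (fun p : {p : P.carrier × P.carrier // p.1 ⋖ p.2} => p.1.1) hee)
      have h2 : t e = t e' := f.injective (congrArg
        (fun p : {p : P.carrier × P.carrier // p.1 ⋖ p.2} => p.1.2) hee)
      exact hr e e' _ _ _ (hs e) (hs e') (ht e) (h2 ▸ ht e') (h1 ▸ .refl)
    · rintro ⟨⟨a, b⟩, hab⟩
      obtain ⟨u, rfl⟩ := f.surjective a
      obtain ⟨v, rfl⟩ := f.surjective b
      obtain ⟨x, ⟨e, h1, h2⟩, h3⟩ := TransGen.head'_iff.1 ((hf2 u v).2 hab.1)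
      rcases reflTransGen_iff_eq_or_transGen.1 h3 with rfl | h3
      · refine ⟨e, Subtype.ext (Prod.ext (congrArg f ?_) (congrArg f ?_))⟩
        · exact Sum.inr.inj ((hs e).symm.trans h1)
        · exact Sum.inl.inj ((ht e).symm.trans h2)
      · exact absurd ((hf2 _ _).1 h3) (hab.2 ((hf2 _ _).1 (.single ⟨e, h1, h2⟩)))
  refine ⟨⟨hin, hout, f, Equiv.ofBijective F hF, hf1, fun e => ?_, fun e => ?_⟩⟩
  · rw [hs]; rfl
  · rw [ht]; rfl

end Slice

/-! ### Hasse diagrams: reducedness and terminals -/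

namespace LabelledPoset

open Slice

variable (P : LabelledPoset T)

theorem hasse_adj_iff {a b : P.carrier} : P.hasse.Adj a b ↔ a ⋖ b := by
  constructor
  · rintro ⟨e, h1, h2⟩
    cases h1
    cases h2
    exact e.2
  · exact fun h => ⟨⟨(a, b), h⟩, rfl, rfl⟩

theorem hasse_reach_iff {a b : P.carrier} : P.hasse.Reach a b ↔ a < b := by
  classical
  have := P.fin
  have := Fintype.ofFinite P.carrier
  let _ : LocallyFiniteOrder P.carrier := Fintype.toLocallyFiniteOrder
  rw [lt_iff_transGen_covBy]
  have : P.hasse.Adj = fun a b : P.carrier => a ⋖ b := by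
    ext a b
    exact P.hasse_adj_iff
  unfold Reach
  rw [this]
  rfl

theorem isClosureOf_hasse : P.IsClosureOf P.hasse :=
  ⟨Equiv.refl _, fun _ => rfl, fun _ _ => P.hasse_reach_iff⟩

theorem hasse_reduced (ρ : ℕ → ℕ → Prop) : P.hasse.Reduced ρ := by
  rw [reduced_iff rfl]
  rintro ⟨⟨a, b⟩, hab⟩ ⟨⟨a', b'⟩, hab'⟩ u u' v hu hu' hv hv' h
  cases hu
  cases hu'
  cases hv
  cases hv'
  rcases reflTransGen_iff_eq_or_transGen.1 h with rfl | h
  · rfl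
  · exact absurd hab'.1 (hab.2 (P.hasse_reach_iff.1 h))

theorem isTwoTerminal_hasse_iff : P.hasse.IsTwoTerminal ↔ P.HasUniqueMinMax := by
  have := P.fin
  have h1 : ∀ v : P.carrier, (¬ ∃ e, P.hasse.tgt e = Sum.inl v) ↔ IsMin v := by
    intro v
    constructor
    · intro h
      by_contra hv
      obtain ⟨u, hu⟩ := exists_covBy_of_wellFoundedGT hv
      exact h ⟨⟨(u, v), hu⟩, rfl⟩
    · rintro hv ⟨e, he⟩
      cases he
      exact hv.not_lt e.2.1
  have h2 : ∀ v : P.carrier, (¬ ∃ e, P.hasse.src e = Sum.inr v) ↔ IsMax v := by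
    intro v
    constructor
    · intro h
      by_contra hv
      obtain ⟨u, hu⟩ := exists_covBy_of_wellFoundedLT hv
      exact h ⟨⟨(v, u), hu⟩, rfl⟩
    · rintro hv ⟨e, he⟩
      cases he
      exact hv.not_lt e.2.1
  constructor
  · rintro ⟨h3, -, h4, -⟩
    exact ⟨(existsUnique_congr h1).1 (h3 rfl), (existsUnique_congr h2).1 (h4 rfl)⟩
  · rintro ⟨h3, h4⟩
    exact ⟨fun _ => (existsUnique_congr h1).2 h3, fun h => absurd rfl h,
      fun _ => (existsUnique_congr h2).2 h4, fun h => absurd rfl h⟩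

end LabelledPoset

namespace Slice

/-! ### Cutting a slice along a lower set of vertices -/

section Cut

variable (K : Slice T) (D : Set K.V)

/-- The edge starts in `D` or at the in-frontier. -/
def StartsIn (e : K.E) : Prop := ∀ a, K.src e = Sum.inr a → a ∈ D

/-- The edge ends in `D`. -/
def EndsIn (e : K.E) : Prop := ∃ b ∈ D, K.tgt e = Sum.inl b

/-- The edges which leave `D` or the in-frontier without ending in `D`. -/
def cutEdges : Set K.E := {e | K.StartsIn D e ∧ ¬ K.EndsIn D e}

/-- The set contains all predecessors of its members. -/
def IsLowerVertexSet : Prop := ∀ a b, K.Adj a b → b ∈ D → a ∈ D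

variable {K D}

theorem EndsIn.startsIn (hD : K.IsLowerVertexSet D) {e : K.E} (he : K.EndsIn D e) :
    K.StartsIn D e := by
  obtain ⟨b, hb, ht⟩ := he
  exact fun a ha => hD a b ⟨e, ha, ht⟩ hb

theorem startsIn_inEdge (i : Fin K.inn) : K.StartsIn D (K.inEdge i) := by
  intro a ha; rw [src_inEdge] at ha; cases ha

theorem not_endsIn_outEdge (j : Fin K.out) : ¬ K.EndsIn D (K.outEdge j) := by
  rintro ⟨b, -, hb⟩; rw [tgt_outEdge] at hb; cases hb

theorem exists_of_not_startsIn {e : K.E} (he : ¬ K.StartsIn D e) :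
    ∃ a : {a // a ∉ D}, K.src e = Sum.inr a.1 := by
  unfold StartsIn at he
  push Not at he
  obtain ⟨a, ha, ha'⟩ := he
  exact ⟨⟨a, ha'⟩, ha⟩

theorem exists_of_endsIn {e : K.E} (he : K.EndsIn D e) :
    ∃ a : {a // a ∈ D}, K.tgt e = Sum.inl a.1 := by
  obtain ⟨b, hb, ht⟩ := he
  exact ⟨⟨b, hb⟩, ht⟩

/-- Source map of the lower part. -/
def lowerSrc (e : {e // K.StartsIn D e}) : Fin K.inn ⊕ {a // a ∈ D} :=
  match hs : K.src e.1 with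
  | Sum.inl i => Sum.inl i
  | Sum.inr a => Sum.inr ⟨a, e.2 a hs⟩

/-- Target map of the upper part. -/
def upperTgt (e : {e // ¬ K.EndsIn D e}) : {a // a ∉ D} ⊕ Fin K.out :=
  match ht : K.tgt e.1 with
  | Sum.inl b => Sum.inl ⟨b, fun hb => e.2 ⟨b, hb, ht⟩⟩
  | Sum.inr j => Sum.inr j

open Classical in
/-- Target map of the lower part. -/
noncomputable def lowerTgt {n : ℕ} (idx : K.cutEdges D ≃ Fin n) (e : {e // K.StartsIn D e}) :
    {a // a ∈ D} ⊕ Fin n :=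
  if h : K.EndsIn D e.1 then Sum.inl (exists_of_endsIn h).choose else Sum.inr (idx ⟨e.1, e.2, h⟩)

open Classical in
/-- Source map of the upper part. -/
noncomputable def upperSrc {n : ℕ} (idx : K.cutEdges D ≃ Fin n) (e : {e // ¬ K.EndsIn D e}) :
    Fin n ⊕ {a // a ∉ D} :=
  if h : K.StartsIn D e.1 then Sum.inl (idx ⟨e.1, h, e.2⟩)
  else Sum.inr (exists_of_not_startsIn h).choose

theorem map_lowerSrc (e : {e // K.StartsIn D e}) :
    Sum.map id Subtype.val (lowerSrc e) = K.src e.1 := by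
  unfold lowerSrc
  split
  · rename_i h; exact h.symm
  · rename_i h; exact h.symm

theorem map_upperTgt (e : {e // ¬ K.EndsIn D e}) :
    Sum.map Subtype.val id (upperTgt e) = K.tgt e.1 := by
  unfold upperTgt
  split
  · rename_i h; exact h.symm
  · rename_i h; exact h.symm

theorem tgt_of_lowerTgt {n : ℕ} {idx : K.cutEdges D ≃ Fin n} {e : {e // K.StartsIn D e}}
    {a : {a // a ∈ D}} (h : lowerTgt idx e = Sum.inl a) : K.tgt e.1 = Sum.inl a.1 := by
  unfold lowerTgt at h
  split at h
  · rename_i he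
    rw [← Sum.inl.inj h]
    exact (exists_of_endsIn he).choose_spec
  · cases h

theorem src_of_upperSrc {n : ℕ} {idx : K.cutEdges D ≃ Fin n} {e : {e // ¬ K.EndsIn D e}}
    {a : {a // a ∉ D}} (h : upperSrc idx e = Sum.inr a) : K.src e.1 = Sum.inr a.1 := by
  unfold upperSrc at h
  split at h
  · cases h
  · rename_i he
    rw [← Sum.inr.inj h]
    exact (exists_of_not_startsIn he).choose_spec

theorem lowerTgt_eq_inr {n : ℕ} {idx : K.cutEdges D ≃ Fin n} {e : {e // K.StartsIn D e}}
    {j : Fin n} : lowerTgt idx e = Sum.inr j ↔ e = ⟨(idx.symm j).1, (idx.symm j).2.1⟩ := by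
  unfold lowerTgt
  constructor
  · intro h
    split at h
    · cases h
    · rw [← Sum.inr.inj h]; simp
  · rintro rfl
    rw [dif_neg (idx.symm j).2.2]
    exact congrArg _ (idx.apply_symm_apply j)

theorem upperSrc_eq_inl {n : ℕ} {idx : K.cutEdges D ≃ Fin n} {e : {e // ¬ K.EndsIn D e}}
    {j : Fin n} : upperSrc idx e = Sum.inl j ↔ e = ⟨(idx.symm j).1, (idx.symm j).2.2⟩ := by
  unfold upperSrc
  constructor
  · intro h
    split at h
    · rw [← Sum.inl.inj h]; simp
    · cases h
  · rintro rfl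
    rw [dif_pos (idx.symm j).2.1]
    exact congrArg _ (idx.apply_symm_apply j)

/-- The lower part of a slice, cut along a set of vertices. -/
noncomputable def lowerPart {n : ℕ} (idx : K.cutEdges D ≃ Fin n) (hne : D.Nonempty) : Slice T where
  inn := K.inn
  out := n
  V := {a // a ∈ D}
  E := {e // K.StartsIn D e}
  finV := have := K.finV; inferInstance
  finE := have := K.finE; inferInstance
  nonemptyV := hne.to_subtype
  label a := K.label a.1
  src := lowerSrc
  tgt := lowerTgt idx
  inEdge i := ⟨K.inEdge i, startsIn_inEdge i⟩
  outEdge j := ⟨(idx.symm j).1, (idx.symm j).2.1⟩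
  src_eq_inl e i := by
    rw [Subtype.ext_iff, ← K.src_eq_inl, ← map_lowerSrc]
    cases lowerSrc e <;> simp
  tgt_eq_inr e j := lowerTgt_eq_inr
  acyclic v hv := by
    refine K.acyclic v.1 (TransGen.lift (p := K.Adj) Subtype.val ?_ _ _ hv)
    rintro a b ⟨e, h1, h2⟩
    exact ⟨e.1, by rw [← map_lowerSrc, h1]; rfl, tgt_of_lowerTgt h2⟩

/-- The upper part of a slice, cut along a set of vertices. -/
noncomputable def upperPart {n : ℕ} (idx : K.cutEdges D ≃ Fin n) (hne : ∃ b, b ∉ D) : Slice T where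
  inn := n
  out := K.out
  V := {a // a ∉ D}
  E := {e // ¬ K.EndsIn D e}
  finV := have := K.finV; inferInstance
  finE := have := K.finE; inferInstance
  nonemptyV := ⟨⟨hne.choose, hne.choose_spec⟩⟩
  label a := K.label a.1
  src := upperSrc idx
  tgt := upperTgt
  inEdge j := ⟨(idx.symm j).1, (idx.symm j).2.2⟩
  outEdge j := ⟨K.outEdge j, not_endsIn_outEdge j⟩
  src_eq_inl e i := upperSrc_eq_inl
  tgt_eq_inr e j := by
    rw [Subtype.ext_iff, ← K.tgt_eq_inr, ← map_upperTgt]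
    cases upperTgt e <;> simp
  acyclic v hv := by
    refine K.acyclic v.1 (TransGen.lift (p := K.Adj) Subtype.val ?_ _ _ hv)
    rintro a b ⟨e, h1, h2⟩
    exact ⟨e.1, src_of_upperSrc h1, by rw [← map_upperTgt, h2]; rfl⟩

/-- The frontier between the parts consists of the cut edges in an arbitrary numbering. Because `D`
is closed under predecessors, an edge ending in `D` belongs to the lower part, so every edge is
accounted for. -/
theorem exists_iso_comp (hD : K.IsLowerVertexSet D) (hne : D.Nonempty) (hne' : ∃ b, b ∉ D) :
    ∃ (A B : Slice T) (h : A.out = B.inn) (f : Iso (A.comp B h) K),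
      (∀ a, f.onV (leftVertex A B h a) ∈ D) ∧ ∀ b, f.onV (rightVertex A B h b) ∉ D := by
  classical
  have := K.finE
  let idx := Finite.equivFin (K.cutEdges D)
  let A := lowerPart idx hne
  let B := upperPart idx hne'
  have h : A.out = B.inn := rfl
  let onV : (A.comp B h).V ≃ K.V := Equiv.sumCompl (· ∈ D)
  let F : (A.comp B h).E → K.E := (Sum.elim (fun e => e.1) (fun e => e.1.1) :
    {e // K.StartsIn D e} ⊕ {e : {e // ¬ K.EndsIn D e} // (B.src e).isRight = true} → K.E)
  have hVl : ∀ a : A.V, onV (leftVertex A B h a) = a.1 := fun a => rfl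
  have hVr : ∀ b : B.V, onV (rightVertex A B h b) = b.1 := fun a => rfl
  have hFl : ∀ e : A.E, F (leftEdge A B h e) = e.1 := fun e => rfl
  have hFr : ∀ e : B.E, F (rightEdge A B h e) = e.1 := by
    intro e
    rcases hs : B.src e with i | v
    · obtain rfl := (B.src_eq_inl _ _).1 hs
      rw [rightEdge_inEdge]
      rfl
    · exact congrArg F (rightEdge_of_isRight A B h e (by rw [hs]; rfl))
  have hA : ∀ e : A.E, K.src e.1 = Sum.map id (fun a : A.V => a.1) (A.src e) :=
    fun e => (map_lowerSrc e).symm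
  have hB : ∀ e : B.E, K.tgt e.1 = Sum.map (fun a : B.V => a.1) id (B.tgt e) :=
    fun e => (map_upperTgt e).symm
  have hA' : ∀ e : A.E, ∀ a, A.tgt e = Sum.inl a → K.tgt e.1 = Sum.inl a.1 :=
    fun e a ha => tgt_of_lowerTgt ha
  have hB' : ∀ e : B.E, ∀ a, B.src e = Sum.inr a → K.src e.1 = Sum.inr a.1 :=
    fun e a ha => src_of_upperSrc ha
  have hF : Function.Bijective F := by
    constructor
    · intro e e' hee
      rcases comp_edge_cases e with ⟨a, v, rfl, ha⟩ | ⟨b, rfl⟩ <;>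
      rcases comp_edge_cases e' with ⟨a', v', rfl, ha'⟩ | ⟨b', rfl⟩
      · exact congrArg _ (Subtype.ext hee)
      · rw [hFl, hFr] at hee
        exact absurd ⟨v.1, v.2, hee ▸ hA' a v ha⟩ b'.2
      · rw [hFl, hFr] at hee
        exact absurd ⟨v'.1, v'.2, hee ▸ hA' a' v' ha'⟩ b.2
      · rw [hFr, hFr] at hee
        exact congrArg _ (Subtype.ext hee)
    · intro e
      by_cases he : K.EndsIn D e
      · exact ⟨leftEdge A B h ⟨e, he.startsIn hD⟩, rfl⟩
      · exact ⟨rightEdge A B h ⟨e, he⟩, hFr _⟩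
  refine ⟨A, B, h, ⟨rfl, rfl, onV, Equiv.ofBijective F hF, ?_, ?_, ?_⟩, fun a => a.2,
    fun b => b.2⟩
  · intro v
    rcases comp_vertex_cases v with ⟨v, rfl⟩ | ⟨v, rfl⟩ <;> rfl
  · intro e
    rw [Equiv.ofBijective_apply]
    rcases comp_edge_cases' A B h e with ⟨a, rfl⟩ | ⟨f, v, rfl, hv⟩
    · rw [hFl, hA, src_leftEdge]
      cases A.src a <;> rfl
    · rw [hFr, hB' f v hv, (src_rightEdge_eq_inr A B h).2 hv]
      rfl
  · intro e
    rw [Equiv.ofBijective_apply]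
    rcases comp_edge_cases e with ⟨a, v, rfl, ha⟩ | ⟨f, rfl⟩
    · rw [hFl, hA' a v ha, tgt_leftEdge_of_inl A B h ha]
      rfl
    · rw [hFr, hB, tgt_rightEdge]
      cases B.tgt f <;> rfl

end Cut

theorem cutEdges_empty (K : Slice T) : (K.cutEdges ∅).ncard = K.inn := by
  have : Set.BijOn K.inEdge Set.univ (K.cutEdges ∅) := by
    refine ⟨fun i _ => ⟨startsIn_inEdge i, fun ⟨b, hb, _⟩ => hb⟩, K.inEdge_injective.injOn, ?_⟩
    rintro e ⟨he, -⟩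
    rcases hs : K.src e with i | a
    · exact ⟨i, trivial, ((K.src_eq_inl _ _).1 hs).symm⟩
    · exact absurd (he a hs) (Set.notMem_empty a)
  rw [← this.image_eq, Set.ncard_image_of_injective _ K.inEdge_injective]
  simp

/-- Vertices without center predecessors are split off one by one, those of `D` first. When `D` is
used up, the in-frontier of the remaining slice is the cut of `D`, so the next unit slice has the
required in-frontier. Thus a width bound on decompositions bounds all cuts. -/
theorem exists_mem_unitDecompositions (K : Slice T) (D : Set K.V) (hD : K.IsLowerVertexSet D)
    (hne : ∃ b, b ∉ D) :
    ∃ w ∈ K.unitDecompositions, ∃ S ∈ w, S.inn = (K.cutEdges D).ncard := by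
  obtain ⟨n, hn⟩ : ∃ n, Nat.card K.V = n := ⟨_, rfl⟩
  induction n using Nat.strong_induction_on generalizing K with
  | _ n ih =>
  have := K.finV
  have : IsTrans K.V (TransGen K.Adj) := ⟨fun _ _ _ => TransGen.trans⟩
  have : Std.Irrefl (TransGen K.Adj) := ⟨K.acyclic⟩
  have hwf := Finite.wellFounded_of_trans_of_irrefl (TransGen K.Adj)
  -- A minimal element of `D` has no predecessor at all, since `D` contains the predecessors of its
  -- members.
  obtain ⟨v, hvD, hv⟩ : ∃ v, (D.Nonempty → v ∈ D) ∧ ∀ u, ¬ K.Adj u v := by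
    by_cases h0 : D.Nonempty
    · obtain ⟨v, hv, hv'⟩ := hwf.has_min D h0
      exact ⟨v, fun _ => hv, fun u hu => hv' u (hD u v hu hv) (.single hu)⟩
    · obtain ⟨v, -, hv'⟩ := hwf.has_min Set.univ ⟨K.nonemptyV.some, trivial⟩
      exact ⟨v, fun h => absurd h h0, fun u hu => hv' u trivial (.single hu)⟩
  by_cases h1 : ∃ b, b ∉ ({v} : Set K.V)
  · obtain ⟨A, B, h, f, hA, hB⟩ := exists_iso_comp (K := K) (D := {v})
      (fun a b hab hb => by rw [Set.mem_singleton_iff.1 hb] at hab; exact absurd hab (hv a))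
      ⟨v, rfl⟩ h1
    have hAunit : A.IsUnitSlice := by
      obtain ⟨a⟩ := A.nonemptyV
      refine ⟨a, trivial, fun b _ => leftVertex_injective A B h (f.onV.injective ?_)⟩
      rw [Set.mem_singleton_iff.1 (hA a), Set.mem_singleton_iff.1 (hA b)]
    have hcard : Nat.card B.V < n := by
      have hle := Nat.card_le_card_of_injective (β := {b // b ≠ v})
        (fun b : B.V => ⟨f.onV (rightVertex A B h b), hB b⟩) fun b b' hb =>
          rightVertex_injective A B h (f.onV.injective (congrArg Subtype.val hb))
      refine hle.trans_lt ?_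
      rw [← hn]
      exact Finite.card_subtype_lt (x := v) (by simp)
    obtain ⟨w, ⟨hw1, hw2⟩, S, hS, hS'⟩ := ih _ hcard B {b | f.onV (rightVertex A B h b) ∈ D}
      (by
        rintro a b ⟨e, he1, he2⟩ hb
        refine hD _ _ ⟨f.onE (rightEdge A B h e), ?_, ?_⟩ hb
        · rw [f.src_eq_inr_iff, src_rightEdge_eq_inr]; exact he1
        · rw [f.tgt_eq_inl_iff, tgt_rightEdge_eq_inl]; exact he2)
      (by
        by_cases h0 : D.Nonempty
        · obtain ⟨b, hb⟩ := hne
          obtain ⟨b, rfl⟩ := f.onV.surjective b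
          rcases comp_vertex_cases b with ⟨b, rfl⟩ | ⟨b, rfl⟩
          · rw [Set.mem_singleton_iff.1 (hA b)] at hb
            exact absurd (hvD h0) hb
          · exact ⟨b, hb⟩
        · obtain ⟨b⟩ := B.nonemptyV
          exact ⟨b, fun hb => h0 ⟨_, hb⟩⟩) rfl
    have hdec : A :: w ∈ K.unitDecompositions :=
      ⟨fun R hR => by
        rcases List.mem_cons.1 hR with rfl | hR
        exacts [hAunit, hw1 R hR], .cons h hw2 ⟨f⟩⟩
    by_cases h0 : D.Nonempty
    · refine ⟨_, hdec, S, List.mem_cons_of_mem _ hS, ?_⟩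
      -- Removing `v ∈ D` does not change the cut: edges out of `v` become in-frontier edges, which
      -- count as starting in the rest of `D`.
      have hbij : Set.BijOn (f.onE ∘ rightEdge A B h)
          (B.cutEdges {b | f.onV (rightVertex A B h b) ∈ D}) (K.cutEdges D) := by
        have hend : ∀ e, K.EndsIn D (f.onE (rightEdge A B h e)) ↔
            B.EndsIn {b | f.onV (rightVertex A B h b) ∈ D} e := by
          intro e
          constructor
          · rintro ⟨b, hb, ht⟩
            obtain ⟨b, rfl⟩ := f.onV.surjective b
            rw [f.tgt_eq_inl_iff] at ht
            rcases comp_vertex_cases b with ⟨b, rfl⟩ | ⟨b, rfl⟩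
            · exact absurd ht (tgt_rightEdge_ne_left A B h e b)
            · exact ⟨b, hb, (tgt_rightEdge_eq_inl A B h).1 ht⟩
          · rintro ⟨b, hb, ht⟩
            exact ⟨_, hb, by rw [f.tgt_eq_inl_iff, tgt_rightEdge_eq_inl]; exact ht⟩
        have hstart : ∀ e, K.StartsIn D (f.onE (rightEdge A B h e)) ↔
            B.StartsIn {b | f.onV (rightVertex A B h b) ∈ D} e := by
          intro e
          constructor
          · intro hs a ha
            exact hs _ (by rw [f.src_eq_inr_iff, src_rightEdge_eq_inr]; exact ha)
          · intro hs a ha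
            obtain ⟨a, rfl⟩ := f.onV.surjective a
            rw [f.src_eq_inr_iff] at ha
            rcases comp_vertex_cases a with ⟨a, rfl⟩ | ⟨a, rfl⟩
            · rw [Set.mem_singleton_iff.1 (hA a)]
              exact hvD h0
            · exact hs a ((src_rightEdge_eq_inr A B h).1 ha)
        refine ⟨fun e he => ⟨(hstart e).2 he.1, mt (hend e).1 he.2⟩,
          (f.onE.injective.comp (rightEdge_injective A B h)).injOn, fun e he => ?_⟩
        obtain ⟨e, rfl⟩ := f.onE.surjective e
        rcases comp_edge_cases e with ⟨a, w, rfl, ha⟩ | ⟨e, rfl⟩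
        · refine absurd ⟨f.onV (leftVertex A B h w), ?_, ?_⟩ he.2
          · rw [Set.mem_singleton_iff.1 (hA w)]
            exact hvD h0
          · rw [f.tgt_eq_inl_iff, tgt_leftEdge_of_inl A B h ha]
        · exact ⟨e, ⟨(hstart e).1 he.1, mt (hend e).2 he.2⟩, rfl⟩
      rw [hS', ← hbij.image_eq, Set.ncard_image_of_injective _
        (f.onE.injective.comp (rightEdge_injective A B h))]
    · refine ⟨_, hdec, A, List.mem_cons_self, ?_⟩
      rw [Set.not_nonempty_iff_eq_empty.1 h0, cutEdges_empty]
      exact f.hinn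
  · push Not at h1
    refine ⟨[K], ⟨?_, .single ⟨Iso.refl K⟩⟩, K, List.mem_cons_self, ?_⟩
    · simpa using ⟨v, trivial, fun b _ => h1 b⟩
    · have h0 : ¬ D.Nonempty := fun h0 => by
        obtain ⟨b, hb⟩ := hne
        rw [Set.mem_singleton_iff.1 (h1 b)] at hb
        exact hb (hvD h0)
      rw [Set.not_nonempty_iff_eq_empty.1 h0, cutEdges_empty]

end Slice

/-! ### Minimal flows -/

section MinFlow

variable {V E : Type} [Fintype E] (src tgt : E → V)

open Classical in
/-- The net amount of `M` leaving the vertex `v`. -/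
noncomputable def netFlow (M : E → ℤ) (v : V) : ℤ :=
  ∑ e, M e * ((if src e = v then 1 else 0) - (if tgt e = v then 1 else 0))

open Classical in
/-- The unit demand at `v`. -/
noncomputable def unitAt (v w : V) : ℤ := if v = w then 1 else 0

theorem netFlow_add (M N : E → ℤ) (v : V) :
    netFlow src tgt (M + N) v = netFlow src tgt M v + netFlow src tgt N v := by
  simp [netFlow, add_mul, Finset.sum_add_distrib]

theorem netFlow_zero (v : V) : netFlow src tgt 0 v = 0 := by
  simp [netFlow]

theorem netFlow_smul (k : ℤ) (M : E → ℤ) (v : V) :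
    netFlow src tgt (k • M) v = k * netFlow src tgt M v := by
  simp [netFlow, Finset.mul_sum, mul_assoc]

theorem netFlow_sum {ι : Type} (s : Finset ι) (M : ι → E → ℤ) (v : V) :
    netFlow src tgt (∑ i ∈ s, M i) v = ∑ i ∈ s, netFlow src tgt (M i) v := by
  classical
  induction s using Finset.induction_on with
  | empty => simp [netFlow_zero]
  | insert i s hi ih => rw [Finset.sum_insert hi, netFlow_add, ih, Finset.sum_insert hi]

open Classical in
theorem netFlow_single (e : E) (k : ℤ) (v : V) :
    netFlow src tgt (Pi.single e k) v = k * (unitAt (src e) v - unitAt (tgt e) v) := by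
  unfold netFlow unitAt
  rw [Finset.sum_eq_single e]
  · simp
  · intro b _ hb
    simp [hb]
  · simp

theorem exists_path_flow {u v : V} (h : ReflTransGen (fun a b => ∃ e, src e = a ∧ tgt e = b) u v) :
    ∃ N : E → ℤ, (∀ e, 0 ≤ N e) ∧ ∀ w, netFlow src tgt N w = unitAt u w - unitAt v w := by
  classical
  induction h with
  | refl => exact ⟨0, fun _ => le_rfl, fun w => by rw [netFlow_zero]; ring⟩
  | tail _ hstep ih =>
    obtain ⟨N, h1, h2⟩ := ih
    obtain ⟨e, rfl, rfl⟩ := hstep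
    refine ⟨N + Pi.single e 1, fun f => add_nonneg (h1 f) ?_, fun w => ?_⟩
    · by_cases hf : f = e
      · subst hf; simp
      · simp [hf]
    · rw [netFlow_add, h2, netFlow_single]; ring

variable {src tgt}

/-- Through each edge a path from `s` to `t` is drawn; the sum of these unit flows is at least 1
everywhere and has value the number of edges. Adding `c` copies of one more path brings the value to
`c + d`. -/
theorem exists_large_flow {s t : V}
    (hs : ∀ v, ReflTransGen (fun a b => ∃ e, src e = a ∧ tgt e = b) s v)
    (ht : ∀ v, ReflTransGen (fun a b => ∃ e, src e = a ∧ tgt e = b) v t) (c : ℕ) :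
    ∃ (d : ℕ) (M : E → ℤ), (∀ e, 1 ≤ M e) ∧
      ∀ w, netFlow src tgt M w = ((c + d : ℕ) : ℤ) * (unitAt s w - unitAt t w) := by
  classical
  choose N hN hN' using fun e => exists_path_flow src tgt (hs (src e))
  choose L hL hL' using fun e => exists_path_flow src tgt (ht (tgt e))
  obtain ⟨Q, hQ, hQ'⟩ := exists_path_flow src tgt (hs t)
  refine ⟨Fintype.card E, (∑ e, (N e + Pi.single e 1 + L e)) + (c : ℤ) • Q, fun e => ?_,
    fun w => ?_⟩
  · have h1 : (1 : ℤ) ≤ ∑ i, (N i + Pi.single i 1 + L i : E → ℤ) e := by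
      refine le_trans ?_ (Finset.single_le_sum (fun i _ => ?_) (Finset.mem_univ e))
      · have := hN e e
        have := hL e e
        simp; omega
      · have := hN i e
        have := hL i e
        have h3 : (0 : ℤ) ≤ (Pi.single i 1 : E → ℤ) e := by
          by_cases hf : e = i
          · subst hf; simp
          · simp [hf]
        simp only [Pi.add_apply]; omega
    have h2 : 0 ≤ (c : ℤ) * Q e := mul_nonneg (by positivity) (hQ e)
    simp only [Pi.add_apply, Finset.sum_apply, Pi.smul_apply, smul_eq_mul] at h1 ⊢
    omega
  · rw [netFlow_add, netFlow_smul, hQ', netFlow_sum]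
    simp only [netFlow_add, netFlow_single, hN', hL']
    rw [Finset.sum_congr rfl (g := fun _ => unitAt s w - unitAt t w) (fun e _ => by ring)]
    simp
    ring

variable (src tgt) in
/-- All vertices in `X` can be reached from `s` by rerouting `M` inside `X`. -/
def IsReroutable (M : E → ℤ) (s : V) (X : Set V) : Prop :=
  s ∈ X ∧ ∀ v ∈ X, ∃ Δ : E → ℤ, (∀ e, Δ e ≠ 0 → src e ∈ X ∧ tgt e ∈ X) ∧
    (∀ e, 1 ≤ M e + Δ e) ∧ ∀ w, netFlow src tgt Δ w = unitAt v w - unitAt s w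

/-- One residual step: lowering the flow on an edge `x → y`, or raising it on an edge `y → x`, moves
the unit of extra supply from `x` to `y`. -/
theorem IsReroutable.insert {M : E → ℤ} {s : V} {X : Set V} (h : IsReroutable src tgt M s X)
    {x y : V} (hx : x ∈ X) (hy : y ∉ X) {e : E} {k : ℤ}
    (he : (src e = x ∧ tgt e = y ∧ k = -1) ∨ (src e = y ∧ tgt e = x ∧ k = 1)) (hk : 1 ≤ M e + k) :
    IsReroutable src tgt M s (insert y X) := by
  classical
  refine ⟨Or.inr h.1, fun v hv => ?_⟩
  rcases hv with rfl | hv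
  · obtain ⟨Δ, h1, h2, h3⟩ := h.2 x hx
    -- This is what confining the support of `Δ` to `X` is for: the edge at the new vertex is still
    -- untouched, so the lower bound only has to be checked against `M e`.
    have he0 : Δ e = 0 := by
      by_contra hne
      obtain ⟨h4, h5⟩ := h1 e hne
      rcases he with ⟨-, rfl, -⟩ | ⟨rfl, -, -⟩
      exacts [hy h5, hy h4]
    refine ⟨Δ + Pi.single e k, fun f hf => ?_, fun f => ?_, fun w => ?_⟩
    · by_cases hfe : f = e
      · subst hfe
        rcases he with ⟨rfl, rfl, -⟩ | ⟨rfl, rfl, -⟩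
        · exact ⟨Or.inr hx, Or.inl rfl⟩
        · exact ⟨Or.inl rfl, Or.inr hx⟩
      · have := h1 f (by simpa [hfe] using hf)
        exact ⟨Or.inr this.1, Or.inr this.2⟩
    · by_cases hfe : f = e
      · subst hfe
        simpa [he0] using hk
      · simpa [hfe] using h2 f
    · rw [netFlow_add, h3, netFlow_single]
      rcases he with ⟨rfl, rfl, rfl⟩ | ⟨rfl, rfl, rfl⟩ <;> ring
  · obtain ⟨Δ, h1, h2, h3⟩ := h.2 v hv
    exact ⟨Δ, fun e he => ⟨Or.inr (h1 e he).1, Or.inr (h1 e he).2⟩, h2, h3⟩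

open Classical in
theorem sum_netFlow [Fintype V] (M : E → ℤ) (X : Finset V) :
    ∑ v ∈ X, netFlow src tgt M v =
      ∑ e, M e * ((if src e ∈ X then 1 else 0) - (if tgt e ∈ X then 1 else 0)) := by
  unfold netFlow
  rw [Finset.sum_comm]
  refine Finset.sum_congr rfl fun e _ => ?_
  rw [← Finset.mul_sum, Finset.sum_sub_distrib]
  simp

/-- Augmenting-path argument in reverse. A maximal reroutable set `X` either contains `t`, and the
flow can be lowered by one, or is a down-closed cut whose leaving edges all carry exactly 1, so that
their number is the value `c + d + 1` of the flow, more than any cut allows. -/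
theorem exists_smaller_flow [Finite V] {s t : V} {c d : ℕ}
    (hcut : ∀ D : Set V, s ∈ D → t ∉ D → (∀ e, tgt e ∈ D → src e ∈ D) →
      {e | src e ∈ D ∧ tgt e ∉ D}.ncard ≤ c)
    {M : E → ℤ} (hM : ∀ e, 1 ≤ M e)
    (hnet : ∀ w, netFlow src tgt M w = ((c + (d + 1) : ℕ) : ℤ) * (unitAt s w - unitAt t w)) :
    ∃ N : E → ℤ, (∀ e, 1 ≤ N e) ∧
      ∀ w, netFlow src tgt N w = ((c + d : ℕ) : ℤ) * (unitAt s w - unitAt t w) := by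
  classical
  have := Fintype.ofFinite V
  obtain ⟨X, hX⟩ := (Set.toFinite {X | IsReroutable src tgt M s X}).exists_maximal
    ⟨{s}, rfl, fun v hv => ⟨0, by simp, by simpa using hM, fun w => by
      rw [netFlow_zero, Set.mem_singleton_iff.1 hv]; ring⟩⟩
  have hmax : ∀ {x y e k}, x ∈ X →
      ((src e = x ∧ tgt e = y ∧ k = -1) ∨ (src e = y ∧ tgt e = x ∧ k = 1)) → 1 ≤ M e + k →
      y ∈ X := by
    intro x y e k hx he hk
    by_contra hy
    exact hy (hX.le_of_ge (hX.prop.insert hx hy he hk) (Set.subset_insert _ _)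
      (Set.mem_insert _ _))
  by_cases ht : t ∈ X
  -- Rerouting to `t` moves one unit of supply from `s` to `t`, where it cancels one unit of demand.
  · obtain ⟨Δ, -, h2, h3⟩ := hX.prop.2 t ht
    refine ⟨M + Δ, h2, fun w => ?_⟩
    rw [netFlow_add, hnet, h3]
    push_cast
    ring
  · exfalso
    -- There are no upper capacities, so raising the flow on an edge into `X` is always allowed.
    have hlow : ∀ e, tgt e ∈ X → src e ∈ X := fun e he =>
      hmax he (Or.inr ⟨rfl, rfl, rfl⟩) (by have := hM e; omega)
    have hone : ∀ e, src e ∈ X → tgt e ∉ X → M e = 1 := by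
      intro e he he'
      by_contra h1
      exact he' (hmax he (Or.inl ⟨rfl, rfl, rfl⟩) (by have := hM e; omega))
    have h1 := hcut X hX.prop.1 ht hlow
    have h2 := sum_netFlow (src := src) (tgt := tgt) M X.toFinset
    have h3 : ∑ v ∈ X.toFinset, netFlow src tgt M v = ((c + (d + 1) : ℕ) : ℤ) := by
      simp only [hnet, unitAt]
      rw [← Finset.mul_sum, Finset.sum_sub_distrib]
      simp [hX.prop.1, ht]
    have h4 : ∀ e, M e * ((if src e ∈ X.toFinset then 1 else 0) -
        (if tgt e ∈ X.toFinset then 1 else 0)) = if src e ∈ X ∧ tgt e ∉ X then 1 else 0 := by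
      intro e
      simp only [Set.mem_toFinset]
      by_cases h5 : src e ∈ X <;> by_cases h6 : tgt e ∈ X
      · simp [h5, h6]
      · simp [h5, h6, hone e h5 h6]
      · exact absurd (hlow e h6) h5
      · simp [h5, h6]
    rw [h3, Finset.sum_congr rfl fun e _ => h4 e, Finset.sum_boole] at h2
    have h5 : ({e | src e ∈ X ∧ tgt e ∉ X} : Set E).ncard =
        (Finset.univ.filter fun e => src e ∈ X ∧ tgt e ∉ X).card := by
      rw [← Set.ncard_coe_finset]
      congr 1
      ext e
      simp
    rw [h5] at h1
    have h6 : c + (d + 1) = (Finset.univ.filter fun e => src e ∈ X ∧ tgt e ∉ X).card := by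
      exact_mod_cast h2
    omega

theorem exists_flow_of_cuts_le [Finite V] {s t : V} {c : ℕ}
    (hs : ∀ v, ReflTransGen (fun a b => ∃ e, src e = a ∧ tgt e = b) s v)
    (ht : ∀ v, ReflTransGen (fun a b => ∃ e, src e = a ∧ tgt e = b) v t)
    (hcut : ∀ D : Set V, s ∈ D → t ∉ D → (∀ e, tgt e ∈ D → src e ∈ D) →
      {e | src e ∈ D ∧ tgt e ∉ D}.ncard ≤ c) :
    ∃ M : E → ℤ, (∀ e, 1 ≤ M e) ∧
      ∀ w, netFlow src tgt M w = (c : ℤ) * (unitAt s w - unitAt t w) := by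
  obtain ⟨d, M, hM, hM'⟩ := exists_large_flow hs ht c
  induction d generalizing M with
  | zero => exact ⟨M, hM, by simpa using hM'⟩
  | succ d ih =>
    obtain ⟨N, hN, hN'⟩ := exists_smaller_flow hcut hM hM'
    exact ih N hN hN'

end MinFlow

open Classical in
theorem finsum_mem_eq_sum_ite {E : Type} [Fintype E] (p : E → Prop) (M : E → ℕ) :
    ∑ᶠ e ∈ {e | p e}, M e = ∑ e, if p e then M e else 0 := by
  rw [finsum_mem_def, finsum_eq_sum_of_fintype]
  simp [Set.indicator]

/-- A finite partial order with least and greatest element, all whose cuts have at most `c` covering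
pairs, has a positive flow of value `c` on its covering pairs. -/
theorem exists_covBy_flow {C : Type} [PartialOrder C] [Finite C] {c : ℕ} {s t : C}
    (hs' : ∀ y : C, IsMin y → y = s) (ht' : ∀ y : C, IsMax y → y = t)
    (hcut : ∀ D : Set C, t ∉ D → (∀ u v, u ⋖ v → v ∈ D → u ∈ D) →
      {e : {p : C × C // p.1 ⋖ p.2} | e.1.1 ∈ D ∧ e.1.2 ∉ D}.ncard ≤ c) :
    ∃ N : {p : C × C // p.1 ⋖ p.2} → ℕ, (∀ e, 1 ≤ N e) ∧
      ∀ v, sumOr c {e | e.1.2 = v} N = sumOr c {e | e.1.1 = v} N := by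
  classical
  have := Fintype.ofFinite C
  let _ : LocallyFiniteOrder C := Fintype.toLocallyFiniteOrder
  have := Fintype.ofFinite {p : C × C // p.1 ⋖ p.2}
  have hsle : ∀ v, s ≤ v := fun v => by
    obtain ⟨b, hb, hb'⟩ := exists_minimal_le_of_wellFoundedLT (fun _ : C => True) v trivial
    rw [minimal_true] at hb'
    exact hs' b hb' ▸ hb
  have htle : ∀ v, v ≤ t := fun v => by
    obtain ⟨b, hb, hb'⟩ := exists_maximal_ge_of_wellFoundedGT (fun _ : C => True) v trivial
    rw [maximal_true] at hb'
    exact ht' b hb' ▸ hb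
  let a : {p : C × C // p.1 ⋖ p.2} → C := fun e => e.1.1
  let b : {p : C × C // p.1 ⋖ p.2} → C := fun e => e.1.2
  have hadj : (fun u v => ∃ e, a e = u ∧ b e = v) = fun u v => u ⋖ v := by
    ext u v
    exact ⟨fun ⟨e, h1, h2⟩ => h1 ▸ h2 ▸ e.2, fun h => ⟨⟨(u, v), h⟩, rfl, rfl⟩⟩
  have hreach : ∀ u v, u ≤ v → ReflTransGen (fun u v => ∃ e, a e = u ∧ b e = v) u v := by
    intro u v huv
    rw [hadj]
    exact le_iff_reflTransGen_covBy.1 huv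
  obtain ⟨M, hM, hM'⟩ := exists_flow_of_cuts_le (src := a) (tgt := b) (c := c)
    (fun v => hreach s v (hsle v)) (fun v => hreach v t (htle v))
    (fun D _ htD hD => hcut D htD fun u v huv hv => hD ⟨(u, v), huv⟩ hv)
  obtain ⟨N, rfl⟩ : ∃ N : {p : C × C // p.1 ⋖ p.2} → ℕ, M = fun e => (N e : ℤ) :=
    ⟨fun e => (M e).toNat, funext fun e => (Int.toNat_of_nonneg (by have := hM e; omega)).symm⟩
  refine ⟨N, fun e => ?_, fun v => ?_⟩
  · have := hM e
    dsimp only at this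
    exact_mod_cast this
  have hin : {e | b e = v}.Nonempty ↔ v ≠ s := by
    constructor
    · rintro ⟨e, he⟩ h
      exact (e.2.lt.trans_eq (he.trans h)).not_ge (hsle _)
    · intro h
      obtain ⟨u, hu⟩ := exists_covBy_of_wellFoundedGT fun h' => h (hs' v h')
      exact ⟨⟨(u, v), hu⟩, rfl⟩
  have hout : {e | a e = v}.Nonempty ↔ v ≠ t := by
    constructor
    · rintro ⟨e, he⟩ h
      exact ((he.trans h).symm.trans_lt e.2.lt).not_ge (htle _)
    · intro h
      obtain ⟨u, hu⟩ := exists_covBy_of_wellFoundedLT fun h' => h (ht' v h')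
      exact ⟨⟨(v, u), hu⟩, rfl⟩
  have hnet := hM' v
  have hsplit : netFlow a b (fun e => (N e : ℤ)) v =
      ((∑ᶠ e ∈ {e | a e = v}, N e : ℕ) : ℤ) - (∑ᶠ e ∈ {e | b e = v}, N e : ℕ) := by
    rw [finsum_mem_eq_sum_ite, finsum_mem_eq_sum_ite]
    push_cast
    rw [← Finset.sum_sub_distrib]
    exact Finset.sum_congr rfl fun e _ => by split_ifs <;> simp
  rw [hsplit] at hnet
  have hempty : ∀ {X : Set {p : C × C // p.1 ⋖ p.2}}, ¬ X.Nonempty → ∑ᶠ e ∈ X, N e = 0 := by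
    intro X hX
    rw [Set.not_nonempty_iff_eq_empty.1 hX, finsum_mem_empty]
  unfold unitAt at hnet
  change sumOr c {e | b e = v} N = sumOr c {e | a e = v} N
  by_cases h1 : v = s <;> by_cases h2 : v = t
  -- The one-element order, where source and sink coincide and both sides take the default `c`. In
  -- the next two cases the default matches the net flow `c` at `s` and `-c` at `t`.
  · rw [sumOr, sumOr, if_neg (by simpa [hin] using h1), if_neg (by simpa [hout] using h2)]
  · rw [sumOr, if_neg (by simpa [hin] using h1), sumOr_of_nonempty (hout.2 h2)]
    rw [hempty (X := {e | b e = v}) (by simpa [hin] using h1), if_pos h1.symm,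
      if_neg (Ne.symm h2)] at hnet
    omega
  · rw [sumOr_of_nonempty (hin.2 h1), sumOr, if_neg (by simpa [hout] using h2)]
    rw [hempty (X := {e | a e = v}) (by simpa [hout] using h2), if_pos h2.symm,
      if_neg (Ne.symm h1)] at hnet
    omega
  · rw [sumOr_of_nonempty (hin.2 h1), sumOr_of_nonempty (hout.2 h2)]
    rw [if_neg (Ne.symm h1), if_neg (Ne.symm h2)] at hnet
    omega

/-! ### Hasse diagrams of bounded width are exactly the good ones -/

namespace LabelledPoset

theorem hasse_src_eq_inr (P : LabelledPoset T) (e : P.hasse.E) (v : P.carrier) :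
    P.hasse.src e = Sum.inr v ↔ e.1.1 = v :=
  ⟨fun h => Sum.inr.inj h, fun h => congrArg Sum.inr h⟩

theorem hasse_tgt_eq_inl (P : LabelledPoset T) (e : P.hasse.E) (v : P.carrier) :
    P.hasse.tgt e = Sum.inl v ↔ e.1.2 = v :=
  ⟨fun h => Sum.inl.inj h, fun h => congrArg Sum.inl h⟩

theorem hasse_hasFlow (P : LabelledPoset T) {c : ℕ} (hP : P.HasUniqueMinMax)
    (hc : P.hasse.GlobalSliceWidthLE c) (m m' : ℕ → ℕ) : P.hasse.HasFlow c m m' := by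
  have := P.fin
  obtain ⟨⟨s, -, hs'⟩, ⟨t, -, ht'⟩⟩ := hP
  obtain ⟨N, hN, hN'⟩ := exists_covBy_flow hs' ht' (c := c) (by
    intro D htD hD
    obtain ⟨w, hw, S, hS, hS'⟩ := P.hasse.exists_mem_unitDecompositions D
      (fun u v huv hv => hD u v (P.hasse_adj_iff.1 huv) hv) ⟨t, htD⟩
    have hcut : {e : {p : P.carrier × P.carrier // p.1 ⋖ p.2} | e.1.1 ∈ D ∧ e.1.2 ∉ D} =
        P.hasse.cutEdges D := by
      refine Set.ext fun e => and_congr ?_ (not_congr ?_)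
      · exact ⟨fun h a ha => (P.hasse_src_eq_inr e a).1 ha ▸ h,
          fun h => h e.1.1 rfl⟩
      · exact ⟨fun h => ⟨e.1.2, h, rfl⟩, fun ⟨b, hb, hb'⟩ => (P.hasse_tgt_eq_inl e b).1 hb' ▸ hb⟩
    rw [hcut]
    exact hS' ▸ (le_max_left _ _).trans (hc w hw S hS))
  refine ⟨N, ⟨hN, fun v => ?_⟩, fun i => i.elim0, fun i => i.elim0,
    fun h => absurd rfl h, fun h => absurd rfl h⟩
  have h1 : {e | P.hasse.tgt e = Sum.inl v} = {e | e.1.2 = v} :=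
    Set.ext fun e => P.hasse_tgt_eq_inl e v
  have h2 : {e | P.hasse.src e = Sum.inr v} = {e | e.1.1 = v} :=
    Set.ext fun e => P.hasse_src_eq_inr e v
  rw [h1, h2]
  exact hN' v

theorem isGood_hasse (P : LabelledPoset T) {c : ℕ} (hP : P.HasUniqueMinMax)
    (hc : P.hasse.GlobalSliceWidthLE c) (ρ : ℕ → ℕ → Prop) (m : ℕ → ℕ) :
    IsGood c P.hasse ρ m :=
  ⟨P.hasse_reduced ρ, ⟨m, P.hasse_hasFlow hP hc m m⟩, P.isTwoTerminal_hasse_iff.2 hP⟩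

/-- The flow of a good diagram induces a run on every unit decomposition, and slices in a run have
width at most `c`. -/
theorem globalSliceWidthLE_hasse (P : LabelledPoset T) {c : ℕ} {ρ : ℕ → ℕ → Prop} {m : ℕ → ℕ}
    (h : IsGood c P.hasse ρ m) : P.hasse.GlobalSliceWidthLE c :=
  fun _ hw => ((hw.2.isGood_iff_run hw.1 rfl ρ m).1 h).width_le

end LabelledPoset

/-! ### The properties of the generator and the main theorem -/

theorem isHasseDiagramGenerator_generator {c n : ℕ} (e : T ≃ Fin n) :
    (generator c e).IsHasseDiagramGenerator := by
  intro H hH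
  obtain ⟨hinn, hout, ⟨ρ, m, hg⟩, -⟩ := mem_graphLanguage_iff.1 hH
  exact hg.1.isTransitiveReduced hinn hout

theorem partialOrderLanguage_generator {c n : ℕ} (e : T ≃ Fin n) :
    (generator c e).partialOrderLanguage =
      {P : LabelledPoset T | P.HasUniqueMinMax ∧ P.hasse.GlobalSliceWidthLE c} := by
  ext P
  constructor
  · rintro ⟨H, hH, hP⟩
    obtain ⟨hinn, hout, ⟨ρ, m, hg⟩, -⟩ := mem_graphLanguage_iff.1 hH
    obtain ⟨f⟩ := nonempty_iso_hasse hinn hout hg.1 hP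
    have hg' := hg.congr f
    exact ⟨P.isTwoTerminal_hasse_iff.1 hg'.2.2, P.globalSliceWidthLE_hasse hg'⟩
  · rintro ⟨h1, h2⟩
    -- The empty cut serves only to provide some unit decomposition.
    obtain ⟨w, hw, -⟩ := P.hasse.exists_mem_unitDecompositions ∅
      (fun _ _ _ h => absurd h (Set.notMem_empty _)) ⟨P.nonempty.some, Set.notMem_empty _⟩
    exact ⟨P.hasse, mem_graphLanguage_iff.2 ⟨rfl, rfl,
      ⟨fun _ _ => False, 0, P.isGood_hasse h1 h2 _ _⟩, w, hw⟩, P.isClosureOf_hasse⟩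

theorem lemma4 :
    ∃ K : ℕ, ∀ (T : Type*) [Finite T] (c : ℕ), 1 ≤ c →
      ∃ G : SliceGraph T,
        G.IsSaturated ∧
        G.IsHasseDiagramGenerator ∧
        G.partialOrderLanguage =
          {P : LabelledPoset T | P.HasUniqueMinMax ∧ P.hasse.GlobalSliceWidthLE c} ∧
        Nat.card G.V ≤ Nat.card T * 2 ^ (K * c ^ 2) := by
  refine ⟨7, fun T _ c hc => ?_⟩
  let e : T ≃ Fin (Nat.card T) := Finite.equivFin T
  refine ⟨generator c e, isSaturated_generator, isHasseDiagramGenerator_generator e,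
    partialOrderLanguage_generator e, ?_⟩
  exact (Nat.card_le_card_of_injective (β := GeneratorState c (Nat.card T)) Subtype.val
    Subtype.val_injective).trans (GeneratorState.natCard_le hc)
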